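/- Let $K$ be an algebraically closed field of characteristic zero (for example $K=\mathbb C$), and let $\rho:\mathfrak g\to\mathrm{gl}(V)$ be a finite-dimensional representation of a finite-dimensional Lie algebra $\mathfrak g$ over $K$. For $x\in V$ let $R_x:\mathfrak g\to V$, $R_x(\xi)=\rho(\xi)x$. The stabiliser of $x$ is $\mathrm{St}_x=\mathrm{Ker}\,R_x$, the tangent space to its orbit is $\mathrm{Im}\,R_x$, so that $\mathrm{codim}\,\mathcal O_x=\dim V-\mathrm{rk}\,R_x$. A point $a\in V$ is regular if $\dim\mathrm{St}_a\le\dim\mathrm{St}_x$ for all $x\in V$; write $\dim\mathrm{St}_{\mathrm{reg}}$ and $\mathrm{codim}\,\mathcal O_{\mathrm{reg}}$ for $\dim\mathrm{St}_a$ and $\mathrm{codim}\,\mathcal O_a$ at a regular point $a$. In suitable bases a pencil $A+\lambda B$ of linear maps between finite-dimensional spaces is block diagonal, with blocks of the following kinds: Jordan blocks, with eigenvalues in $K\cup\{\infty\}$; horizontal Kronecker blocks of size $\varepsilon\times(\varepsilon+1)$, $\varepsilon\ge 0$, with entries $1$ on the diagonal and $\lambda$ immediately to the right of it; and vertical Kronecker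 blocks of size $(\eta+1)\times\eta$, $\eta\ge0$, which are the transposes of horizontal ones (a zero $g\times h$ block is regarded as the sum of $g$ vertical blocks of size $1\times 0$ and $h$ horizontal blocks of size $0\times1$). The numbers $\varepsilon$ (one for each horizontal block) are the minimal column indices of the pencil and the numbers $\eta$ (one for each vertical block) are its minimal row indices. The algebraic type of the pencil consists of the number of distinct eigenvalues of its Jordan blocks, the number and sizes of the Jordan blocks for each eigenvalue, and the minimal column and row indices. A pair $(x,a)\in V\times V$ is generic if it belongs to a Zariski open subset of $V\times V$ on which the algebraic type of the pencil $R_x+\lambda R_a$ is constant. The algebraic type of $R_x+\lambda R_a$ for a generic pair $(x,a)$ is the Jordan--Kronecker invariant of $\rho$, and its minimal column and row indices are called the minimal column and row indices of $\rho$. Proposition. The Jordan--Kronecker invariant of $\rho$ exists (i.e. there are generic pairs), and 1) the number $p$ of minimal column indices of $\rho$ (i.e. the number of horizontal Kronecker blocks of a generic pencil) is equal to $\dim\mathrm{St}_{\mathrm{reg}}$; 2) the number $q$ of minimal row indices of $\rho$ (i.e. the number of vertical Kronecker blocks of a generic pencil) is equal to $\mathrm{codim}\,\mathcal O_{\mathrm{reg}}$.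 -/

import Mathlib

namespace JordanKronecker

/-- The blocks of the Jordan–Kronecker canonical form of a pencil `A + λ B`.
A horizontal Kronecker block `horizontal ε` has size `ε × (ε + 1)` and a vertical one
`vertical η` has size `(η + 1) × η`; the cases `ε = 0` and `η = 0` are allowed, so that the zero
`g × h` block is the sum of `g` blocks `vertical 0` and `h` blocks `horizontal 0`. -/
inductive Block (K : Type*) where
  /-- Jordan block with finite eigenvalue `c` and size `n × n`, `n ≥ 1`. -/
  | jordan (c : K) (n : ℕ+) : Block K
  /-- Jordan block with eigenvalue `∞` and size `n × n`, `n ≥ 1`. -/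
  | jordanInfty (n : ℕ+) : Block K
  /-- Horizontal Kronecker block. -/
  | horizontal (ε : ℕ) : Block K
  /-- Vertical Kronecker block. -/
  | vertical (η : ℕ) : Block K

namespace Block

/-- The number of rows of a block. -/
def rows {K : Type*} : Block K → ℕ
  | jordan _ n => n
  | jordanInfty n => n
  | horizontal ε => ε
  | vertical η => η + 1

/-- The number of columns of a block. -/
def cols {K : Type*} : Block K → ℕ
  | jordan _ n => n
  | jordanInfty n => n
  | horizontal ε => ε + 1
  | vertical η => η

/-- The entry of the matrix `A` of a block in row `i` and column `j` (numbered from `0`). -/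
def entryA {K : Type*} [Zero K] [One K] : Block K → ℕ → ℕ → K
  | jordan c _, i, j => if i = j then c else if i + 1 = j then 1 else 0
  | jordanInfty _, i, j => if i = j then 1 else 0
  | horizontal _, i, j => if i = j then 1 else 0
  | vertical _, i, j => if i = j then 1 else 0

/-- The entry of the matrix `B` of a block in row `i` and column `j` (numbered from `0`). -/
def entryB {K : Type*} [Zero K] [One K] : Block K → ℕ → ℕ → K
  | jordan _ _, i, j => if i = j then 1 else 0
  | jordanInfty _, i, j => if i + 1 = j then 1 else 0
  | horizontal _, i, j => if i + 1 = j then 1 else 0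
  | vertical _, i, j => if i = j + 1 then 1 else 0

/-- The matrix `A` of a block. -/
def matA {K : Type*} [Zero K] [One K] (b : Block K) : Matrix (Fin b.rows) (Fin b.cols) K :=
  Matrix.of fun i j => b.entryA i j

/-- The matrix `B` of a block. -/
def matB {K : Type*} [Zero K] [One K] (b : Block K) : Matrix (Fin b.rows) (Fin b.cols) K :=
  Matrix.of fun i j => b.entryB i j

/-- The eigenvalue, in `K ∪ {∞}`, and the size of a Jordan block. -/
def jordanData? {K : Type*} : Block K → Option (OnePoint K × ℕ)
  | jordan c n => some ((c : OnePoint K), (n : ℕ))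
  | jordanInfty n => some (OnePoint.infty, (n : ℕ))
  | horizontal _ => none
  | vertical _ => none

/-- The minimal column index of a horizontal Kronecker block: its number of rows. -/
def columnIndex? {K : Type*} : Block K → Option ℕ
  | jordan _ _ => none
  | jordanInfty _ => none
  | horizontal ε => some ε
  | vertical _ => none

/-- The minimal row index of a vertical Kronecker block: its number of columns. -/
def rowIndex? {K : Type*} : Block K → Option ℕ
  | jordan _ _ => none
  | jordanInfty _ => none
  | horizontal _ => none
  | vertical η => some η

end Block

/-- In suitable bases of `U` and `W` the matrices of the linear maps `A, B : U → W` are block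
diagonal, with the diagonal blocks `blk 0, …, blk (k - 1)`. -/
def HasCanonicalForm {K U W : Type*} [Field K] [AddCommGroup U] [Module K U]
    [AddCommGroup W] [Module K W] (A B : U →ₗ[K] W) {k : ℕ} (blk : Fin k → Block K) : Prop :=
  ∃ (bU : Module.Basis (Σ i : Fin k, Fin (blk i).cols) K U)
    (bW : Module.Basis (Σ i : Fin k, Fin (blk i).rows) K W),
    LinearMap.toMatrix bU bW A = Matrix.blockDiagonal' (fun i => (blk i).matA) ∧
    LinearMap.toMatrix bU bW B = Matrix.blockDiagonal' (fun i => (blk i).matB)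

/-- The discrete invariants of a pencil. -/
structure AlgebraicType where
  /-- One member for each distinct eigenvalue (in `K ∪ {∞}`) of the Jordan blocks, namely the
  multiset of the sizes of the Jordan blocks with this eigenvalue. -/
  jordanSizes : Multiset (Multiset ℕ)
  /-- The minimal column indices: the numbers of rows of the horizontal Kronecker blocks. -/
  minColumnIndices : Multiset ℕ
  /-- The minimal row indices: the numbers of columns of the vertical Kronecker blocks. -/
  minRowIndices : Multiset ℕ

open Classical in
/-- The algebraic type read off from a multiset of blocks. -/
noncomputable def AlgebraicType.ofBlocks {K : Type*} (s : Multiset (Block K)) :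
    AlgebraicType where
  jordanSizes :=
    ((s.filterMap Block.jordanData?).map Prod.fst).dedup.map fun e =>
      ((s.filterMap Block.jordanData?).filter fun d => d.1 = e).map Prod.snd
  minColumnIndices := s.filterMap Block.columnIndex?
  minRowIndices := s.filterMap Block.rowIndex?

/-- The pencil `A + λ B` has algebraic type `T`: it has a canonical form whose blocks
yield `T`. -/
def HasAlgebraicType {K U W : Type*} [Field K] [AddCommGroup U] [Module K U]
    [AddCommGroup W] [Module K W] (A B : U →ₗ[K] W) (T : AlgebraicType) : Prop :=
  ∃ (k : ℕ) (blk : Fin k → Block K), HasCanonicalForm A B blk ∧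
    AlgebraicType.ofBlocks (Finset.univ.val.map blk) = T

/-- A subset of a finite-dimensional vector space `W` is Zariski open if its complement is the
set of common zeros of a set of polynomial functions, i.e. of polynomials in linear
functionals on `W`. -/
def IsZariskiOpen (K : Type*) {W : Type*} [Field K] [AddCommGroup W] [Module K W]
    (S : Set W) : Prop :=
  ∃ P : Set (MvPolynomial (Module.Dual K W) K),
    Sᶜ = {w | ∀ p ∈ P, MvPolynomial.eval (fun φ : Module.Dual K W => φ w) p = 0}

end JordanKronecker

/- The commutator bracket on associative rings, in particular on `Module.End K V` (this is
`gl(V)`), is not a global instance. -/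
attribute [local instance] LieRing.ofAssociativeRing

namespace JordanKronecker

section Representation

variable {K 𝔤 V : Type*} [Field K] [LieRing 𝔤] [LieAlgebra K 𝔤] [AddCommGroup V] [Module K V]

/-- The operator `R_x : 𝔤 → V`, `R_x ξ = ρ(ξ) x`. -/
def R (ρ : 𝔤 →ₗ⁅K⁆ Module.End K V) (x : V) : 𝔤 →ₗ[K] V :=
  LinearMap.flip (ρ : 𝔤 →ₗ[K] V →ₗ[K] V) x

/-- The stabiliser `St_x = Ker R_x` of `x`. -/
def stabiliser (ρ : 𝔤 →ₗ⁅K⁆ Module.End K V) (x : V) : Submodule K 𝔤 :=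
  LinearMap.ker (R ρ x)

/-- The tangent space `T_x O_x = Im R_x` at `x` to the orbit of `x`. -/
def orbitTangent (ρ : 𝔤 →ₗ⁅K⁆ Module.End K V) (x : V) : Submodule K V :=
  LinearMap.range (R ρ x)

/-- The codimension in `V` of the orbit of `x`. -/
noncomputable def orbitCodim (ρ : 𝔤 →ₗ⁅K⁆ Module.End K V) (x : V) : ℕ :=
  Module.finrank K (V ⧸ orbitTangent ρ x)

/-- A point is regular if its stabiliser has the smallest possible dimension. -/
def IsRegular (ρ : 𝔤 →ₗ⁅K⁆ Module.End K V) (a : V) : Prop :=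
  ∀ x : V, Module.finrank K (stabiliser ρ a) ≤ Module.finrank K (stabiliser ρ x)

theorem exists_isRegular (ρ : 𝔤 →ₗ⁅K⁆ Module.End K V) : ∃ a, IsRegular ρ a :=
  ⟨Function.argmin fun x => Module.finrank K (stabiliser ρ x),
    fun x => Function.argmin_le (fun x => Module.finrank K (stabiliser ρ x)) x⟩

/-- The pair `(x, a)` is generic: it lies in a Zariski open subset of `V × V` on which the
algebraic type of the pencil `R_x + λ R_a` is one and the same. -/
def IsGenericPair (ρ : 𝔤 →ₗ⁅K⁆ Module.End K V) (x a : V) : Prop :=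
  ∃ S : Set (V × V), IsZariskiOpen K S ∧ (x, a) ∈ S ∧
    ∃ T : AlgebraicType, ∀ p ∈ S, HasAlgebraicType (R ρ p.1) (R ρ p.2) T

/-- `T` is the Jordan–Kronecker invariant of `ρ`: the algebraic type of a generic pencil
`R_x + λ R_a`. -/
def IsJordanKroneckerInvariant (ρ : 𝔤 →ₗ⁅K⁆ Module.End K V) (T : AlgebraicType) : Prop :=
  ∃ x a : V, IsGenericPair ρ x a ∧ HasAlgebraicType (R ρ x) (R ρ a) T

end Representation

end JordanKronecker

/-! Counting. In a canonical form of `A + c B`, a horizontal block adds exactly one dimension to the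
kernel for every `c`; vertical blocks and Jordan blocks at infinity add nothing; a Jordan block with
eigenvalue `e` adds something only for `c = -e`. So the number `p` of horizontal blocks is the
minimum of `dim Ker (A + c B)`, attained for all but finitely many `c`, and comparing numbers of
rows and columns gives `dim W + p = dim U + q` (`HasAlgebraicType.card_minColumnIndices`). Since
`R_x + c R_a = R_{x + c a}`, these kernels are stabilisers. If `x` is regular, then `p ≤ dim St_x`
by taking `c = 0`, and `p ≥ dim St_x` because some `x + c a` has stabiliser of dimension `p`. A
generic pair can be moved inside its open set to one with regular first member
(`exists_isRegular_mem`). The value of `q` follows by rank-nullity.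

Existence of generic pairs. Every pencil has a canonical form (`exists_hasCanonicalForm`): extremal
chains of vectors, paired with dual chains of functionals, split off one block at a time. Replacing
eigenvalues by labels leaves finitely many skeletons, each of which determines the algebraic type.
The pairs with a given skeleton form the projection of an affine algebraic set, which by Chevalley's
theorem lies in a hypersurface or contains the complement of one (`projection_dichotomy`). Finitely
many such projections cover the whole space, so one of them contains the complement of a
hypersurface, and there the type is constant. -/

namespace JordanKronecker

/-! ### Projections of affine algebraic sets -/

section Chevalley

variable {K σ τ : Type*} [Field K] [IsAlgClosed K] [Finite σ] [Finite τ]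

/-- The map from polynomials in the variables `σ` to the coordinate ring of the zero locus of a set
of polynomials in the variables `σ ⊕ τ`. -/
noncomputable def projectionHom (S : Set (MvPolynomial (σ ⊕ τ) K)) :
    MvPolynomial σ K →+* MvPolynomial (σ ⊕ τ) K ⧸ Ideal.span S :=
  (Ideal.Quotient.mk _).comp (MvPolynomial.rename Sum.inl).toRingHom

omit [IsAlgClosed K] in
theorem projectionHom_finitePresentation (S : Set (MvPolynomial (σ ⊕ τ) K)) :
    (projectionHom S).FinitePresentation := by
  apply RingHom.FinitePresentation.of_finiteType.1
  refine RingHom.FiniteType.of_comp_finiteType (f := MvPolynomial.C) ?_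
  have h : (projectionHom S).comp MvPolynomial.C =
      (Ideal.Quotient.mk _).comp (MvPolynomial.C) := by
    ext; simp [projectionHom]
  rw [h]
  refine RingHom.FiniteType.comp_surjective ?_ Ideal.Quotient.mk_surjective
  have : Algebra.FiniteType K (MvPolynomial (σ ⊕ τ) K) := inferInstance
  rwa [← RingHom.finiteType_algebraMap] at this

omit [IsAlgClosed K] [Finite τ] [Finite σ] in
theorem eval_eq_zero_of_mem_span {ι : Type*} {S : Set (MvPolynomial ι K)} {w : ι → K}
    (hw : ∀ p ∈ S, MvPolynomial.eval w p = 0) {p : MvPolynomial ι K} (hp : p ∈ Ideal.span S) :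
    MvPolynomial.eval w p = 0 := by
  have : Ideal.span S ≤ RingHom.ker (MvPolynomial.eval w) := Ideal.span_le.2 hw
  exact this hp

/-- A point of the prime spectrum defined by a `K`-point is hit by the spectrum of the coordinate
ring only if it lifts to a `K`-point. -/
theorem exists_lift_of_mem_range (S : Set (MvPolynomial (σ ⊕ τ) K)) (x : σ → K)
    (hx : MvPolynomial.pointToPoint (k := K) x ∈
      Set.range (PrimeSpectrum.comap (projectionHom S))) :
    ∃ y : τ → K, ∀ p ∈ S, MvPolynomial.eval (Sum.elim x y) p = 0 := by
  obtain ⟨P, hP⟩ := hx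
  -- The prime over the point need not be maximal, but a maximal ideal above it still contains every
  -- `X i - x i`; by the Nullstellensatz it is a `K`-point, whose first coordinates are therefore
  -- `x`.
  obtain ⟨M, hM, hPM⟩ := P.asIdeal.exists_le_maximal P.2.ne_top
  have hM' : (M.comap (Ideal.Quotient.mk (Ideal.span S))).IsMaximal :=
    Ideal.comap_isMaximal_of_surjective _ Ideal.Quotient.mk_surjective
  obtain ⟨w, hw⟩ := MvPolynomial.eq_vanishingIdeal_singleton_of_isMaximal K hM'
  have hwx : ∀ i, w (Sum.inl i) = x i := by
    intro i
    have h1 : MvPolynomial.X i - MvPolynomial.C (x i) ∈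
        (MvPolynomial.pointToPoint (k := K) x).asIdeal := by
      simp [MvPolynomial.pointToPoint]
    rw [← hP] at h1
    have h2 := hPM h1
    have h3 : (MvPolynomial.X (Sum.inl i) - MvPolynomial.C (x i) : MvPolynomial (σ ⊕ τ) K) ∈
        M.comap (Ideal.Quotient.mk (Ideal.span S)) := by
      simpa [projectionHom] using h2
    rw [hw, MvPolynomial.mem_vanishingIdeal_singleton_iff] at h3
    simpa [sub_eq_zero] using h3
  have hwe : w = Sum.elim x (fun j => w (Sum.inr j)) := by
    ext (i | j)
    · exact hwx i
    · rfl
  refine ⟨fun j => w (Sum.inr j), fun p hp => ?_⟩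
  rw [← hwe]
  have : p ∈ M.comap (Ideal.Quotient.mk (Ideal.span S)) := by
    rw [Ideal.mem_comap, Ideal.Quotient.eq_zero_iff_mem.2 (Ideal.subset_span hp)]
    exact M.zero_mem
  rw [hw, MvPolynomial.mem_vanishingIdeal_singleton_iff] at this
  simpa using this

/-- **Chevalley's theorem** for projections of affine algebraic sets: the projection is either
contained in a hypersurface or contains the complement of a hypersurface. -/
theorem projection_dichotomy (S : Set (MvPolynomial (σ ⊕ τ) K)) :
    (∃ f : MvPolynomial σ K, f ≠ 0 ∧ ∀ x y, (∀ p ∈ S, MvPolynomial.eval (Sum.elim x y) p = 0) →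
      MvPolynomial.eval x f = 0) ∨
    ∃ f : MvPolynomial σ K, f ≠ 0 ∧ ∀ x, MvPolynomial.eval x f ≠ 0 →
      ∃ y : τ → K, ∀ p ∈ S, MvPolynomial.eval (Sum.elim x y) p = 0 := by
  by_cases hinj : Function.Injective (projectionHom S)
  · right
    -- By injectivity the generic point lies in the constructible image, hence in one of its pieces,
    -- given by `g i = 0` and `f ≠ 0`. This forces all `g i = 0` and `f ≠ 0` as polynomials, so the
    -- piece is the whole complement of the hypersurface `f = 0`.
    obtain ⟨q, hq, hq'⟩ := Ideal.exists_comap_eq_of_mem_minimalPrimes_of_injective hinj ⊥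
      (by rw [IsDomain.minimalPrimes_eq_singleton_bot]; rfl)
    obtain ⟨D, hD⟩ := PrimeSpectrum.exists_constructibleSetData_iff.2
      (PrimeSpectrum.isConstructible_range_comap (projectionHom_finitePresentation S))
    have hmem : (⟨⊥, Ideal.isPrime_bot⟩ : PrimeSpectrum (MvPolynomial σ K)) ∈ D.toSet := by
      rw [hD]
      exact ⟨⟨q, hq⟩, PrimeSpectrum.ext hq'⟩
    obtain ⟨C, hC, h1, h2⟩ : ∃ C ∈ D, _ ∈ C.toSet := by
      simpa [PrimeSpectrum.ConstructibleSetData.toSet] using hmem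
    have hg : ∀ i, C.g i = 0 := fun i => by
      have := h1 ⟨i, rfl⟩
      simpa using this
    refine ⟨C.f, fun h => h2 (by simp [h]), fun x hx => exists_lift_of_mem_range S x ?_⟩
    rw [← hD]
    refine Set.mem_biUnion hC ⟨?_, ?_⟩
    · rintro _ ⟨i, rfl⟩
      rw [hg]
      exact Ideal.zero_mem _
    · intro h
      have : C.f ∈ (MvPolynomial.pointToPoint (k := K) x).asIdeal := h rfl
      apply hx
      simpa [MvPolynomial.pointToPoint, MvPolynomial.mem_vanishingIdeal_singleton_iff] using this
  · left
    rw [injective_iff_map_eq_zero] at hinj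
    push Not at hinj
    obtain ⟨f, hf, hf0⟩ := hinj
    refine ⟨f, hf0, fun x y h => ?_⟩
    have h1 : MvPolynomial.rename Sum.inl f ∈ Ideal.span S := by
      rw [← Ideal.Quotient.eq_zero_iff_mem]
      exact hf
    have h2 := eval_eq_zero_of_mem_span h h1
    rw [MvPolynomial.eval_rename] at h2
    exact h2

/-- If finitely many algebraic sets over an affine space jointly project onto it, then one of the
projections contains the complement of a hypersurface. -/
theorem exists_generic_of_cover {ι : Type*} [Finite ι] {τ : ι → Type*} [∀ i, Finite (τ i)]
    (S : ∀ i, Set (MvPolynomial (σ ⊕ τ i) K))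
    (hS : ∀ x : σ → K, ∃ i, ∃ y : τ i → K, ∀ p ∈ S i, MvPolynomial.eval (Sum.elim x y) p = 0) :
    ∃ i, ∃ f : MvPolynomial σ K, f ≠ 0 ∧ ∀ x, MvPolynomial.eval x f ≠ 0 →
      ∃ y : τ i → K, ∀ p ∈ S i, MvPolynomial.eval (Sum.elim x y) p = 0 := by
  by_contra hcon
  rw [not_exists] at hcon
  choose f hf0 hf using fun i => (projection_dichotomy (S i)).resolve_right (hcon i)
  have := Fintype.ofFinite ι
  -- The product of the equations of the hypersurfaces would be a nonzero polynomial vanishing at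
  -- every point.
  refine Finset.prod_ne_zero_iff.2 (fun i _ => hf0 i : ∀ i ∈ Finset.univ, f i ≠ 0) ?_
  refine MvPolynomial.funext fun x => ?_
  obtain ⟨i, y, h⟩ := hS x
  rw [map_prod, map_zero]
  exact Finset.prod_eq_zero (Finset.mem_univ i) (hf i x y h)

end Chevalley

end JordanKronecker

namespace JordanKronecker

/-! ### Chains of vectors and dual chains of functionals -/

section Chains

variable {K U W : Type*} [Field K] [AddCommGroup U] [Module K U] [AddCommGroup W] [Module K W]

/-- The iterated image of a subspace under the linear relation `B ∘ A⁻¹` on `W`. -/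
def reach (A B : U →ₗ[K] W) (D : Submodule K W) (n : ℕ) : Submodule K W :=
  (fun S : Submodule K W => (S.comap A).map B)^[n] D

theorem reach_succ (A B : U →ₗ[K] W) (D : Submodule K W) (n : ℕ) :
    reach A B D (n + 1) = ((reach A B D n).comap A).map B :=
  Function.iterate_succ_apply' _ _ _

/-- Prepending a term to a sequence. -/
def prepend {X : Type*} (x : X) (s : ℕ → X) : ℕ → X
  | 0 => x
  | n + 1 => s n

/-- Lets extremality of a chain be stated as non-membership in a subspace, which duality turns into
functionals. -/
theorem apply_mem_reach_iff (A B : U →ₗ[K] W) (D : Submodule K W) (n : ℕ) (x : U) :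
    A x ∈ reach A B D n ↔
      ∃ e : ℕ → U, e 0 = x ∧ (∀ i < n, A (e i) = B (e (i + 1))) ∧ A (e n) ∈ D := by
  induction n generalizing x with
  | zero =>
    constructor
    · intro h
      exact ⟨fun _ => x, rfl, fun i hi => absurd hi (Nat.not_lt_zero i), h⟩
    · rintro ⟨e, rfl, -, h⟩
      exact h
  | succ n ih =>
    rw [reach_succ, Submodule.mem_map]
    constructor
    · rintro ⟨y, hy, hxy⟩
      obtain ⟨e, rfl, he, hD⟩ := (ih y).1 hy
      refine ⟨prepend x e, rfl, fun i hi => ?_, hD⟩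
      rcases i with _ | i
      · exact hxy.symm
      · exact he i (by omega)
    · rintro ⟨e, rfl, he, hD⟩
      refine ⟨e 1, (ih _).2 ⟨fun i => e (i + 1), rfl, fun i hi => he _ (by omega), hD⟩, ?_⟩
      exact (he 0 (by omega)).symm

/-- If `ψ₀` annihilates `B (A⁻¹ S)`, then `ψ₀ ∘ B` vanishes on the kernel of `U → W → W / S`, hence
factors as `ψ₁ ∘ A` with `ψ₁` annihilating `S`; iterate. -/
theorem exists_dual_chain (A B : U →ₗ[K] W) (D : Submodule K W) (n : ℕ) (ψ₀ : Module.Dual K W)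
    (h : ψ₀ ∈ (reach A B D n).dualAnnihilator) :
    ∃ ψ : ℕ → Module.Dual K W, ψ 0 = ψ₀ ∧ (∀ i < n, ψ i ∘ₗ B = ψ (i + 1) ∘ₗ A) ∧
      ψ n ∈ D.dualAnnihilator := by
  induction n generalizing ψ₀ with
  | zero => exact ⟨fun _ => ψ₀, rfl, fun i hi => absurd hi (Nat.not_lt_zero i), h⟩
  | succ n ih =>
    rw [reach_succ, Submodule.mem_dualAnnihilator] at h
    have h1 : ψ₀ ∘ₗ B ∈ (LinearMap.ker ((reach A B D n).mkQ ∘ₗ A)).dualAnnihilator := by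
      rw [Submodule.mem_dualAnnihilator]
      intro x hx
      refine h _ (Submodule.mem_map_of_mem ?_)
      simpa using hx
    rw [← LinearMap.range_dualMap_eq_dualAnnihilator_ker] at h1
    obtain ⟨χ, hχ⟩ := h1
    obtain ⟨ψ, h0, hψ, hD⟩ := ih (χ ∘ₗ (reach A B D n).mkQ) (by
      rw [Submodule.mem_dualAnnihilator]
      intro w hw
      simp [(Submodule.Quotient.mk_eq_zero _).2 hw])
    refine ⟨prepend ψ₀ ψ, rfl, fun i hi => ?_, hD⟩
    rcases i with _ | i
    · change ψ₀ ∘ₗ B = ψ 0 ∘ₗ A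
      rw [h0, ← hχ]
      rfl
    · exact hψ i (by omega)

theorem exists_dual_chain_of_notMem (A B : U →ₗ[K] W) (D : Submodule K W) (n : ℕ) (w : W)
    (h : w ∉ reach A B D n) :
    ∃ ψ : ℕ → Module.Dual K W, ψ 0 w ≠ 0 ∧ (∀ i < n, ψ i ∘ₗ B = ψ (i + 1) ∘ₗ A) ∧
      ∀ d ∈ D, ψ n d = 0 := by
  obtain ⟨f, hf, hf'⟩ := Submodule.exists_dual_map_eq_bot_of_notMem h inferInstance
  obtain ⟨ψ, h0, hψ, hD⟩ := exists_dual_chain A B D n f (by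
    rw [Submodule.mem_dualAnnihilator]
    intro x hx
    have := Submodule.mem_map_of_mem (f := f) hx
    rwa [hf', Submodule.mem_bot] at this)
  exact ⟨ψ, by rwa [h0], hψ, fun d hd => (Submodule.mem_dualAnnihilator _).1 hD d hd⟩

/-- A sequence `e 0, …, e n` defines a nonzero solution of degree `n` of `(A - λ B) e(λ) = 0`. -/
def IsSingularChain (A B : U →ₗ[K] W) (n : ℕ) (e : ℕ → U) : Prop :=
  e 0 ≠ 0 ∧ B (e 0) = 0 ∧ (∀ i < n, A (e i) = B (e (i + 1))) ∧ A (e n) = 0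

/-- A singular chain of minimal length can be split off by means of functionals. -/
theorem exists_singular_splitting (A B : U →ₗ[K] W) (h : ∃ n e, IsSingularChain A B n e) :
    ∃ (n : ℕ) (e : ℕ → U) (φ : ℕ → Module.Dual K U) (ψ : ℕ → Module.Dual K W),
      IsSingularChain A B n e ∧ (∀ i < n, ψ i ∘ₗ A = φ i) ∧ (∀ i < n, ψ i ∘ₗ B = φ (i + 1)) ∧
      φ 0 (e 0) ≠ 0 := by
  classical
  obtain ⟨e, he⟩ := Nat.find_spec h
  have hmin : ∀ m < Nat.find h, ¬ ∃ e, IsSingularChain A B m e := fun m hm => Nat.find_min h hm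
  generalize Nat.find h = n at he hmin
  rcases n with _ | n
  · obtain ⟨φ, hφ⟩ := Module.Projective.exists_dual_ne_zero K he.1
    exact ⟨0, e, fun _ => φ, fun _ => 0, he, by simp, by simp, hφ⟩
  -- Membership would give a singular chain with the same first vector and length one less.
  · have hnot : A (e 0) ∉ reach A B ⊥ n := by
      rw [apply_mem_reach_iff]
      rintro ⟨e', h0, h1, h2⟩
      refine hmin n (Nat.lt_succ_self n) ⟨e', ?_, ?_, h1, by simpa using h2⟩
      · rw [h0]; exact he.1
      · rw [h0]; exact he.2.1
    obtain ⟨ψ, h0, h1, -⟩ := exists_dual_chain_of_notMem A B ⊥ n _ hnot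
    -- There is one more `φ` than usable `ψ`: the dual chain relations stop at `ψ n`, so the last
    -- `φ` is defined through `B`.
    refine ⟨n + 1, e, fun i => if i = n + 1 then ψ n ∘ₗ B else ψ i ∘ₗ A, ψ, he, ?_, ?_, ?_⟩
    · intro i hi
      simp [hi.ne]
    · intro i hi
      rcases (Nat.lt_succ_iff_lt_or_eq.1 hi) with hi | rfl
      · simp [hi.ne, h1 i hi]
      · simp
    · simpa using h0

/-- A sequence `e 0, …, e n` is a Jordan chain for the eigenvalue `∞`. -/
def IsJordanChain (A B : U →ₗ[K] W) (n : ℕ) (e : ℕ → U) : Prop :=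
  e 0 ≠ 0 ∧ B (e 0) = 0 ∧ ∀ i < n, A (e i) = B (e (i + 1))

/-- With `T = (A - c B)⁻¹ B` the chain relations give `T^i (e i) = e 0` and `T (e 0) = 0`, so `e n`
lies in `Ker T^(n+1)` but not in `Ker T^n`, while these kernels stabilise by the exponent `dim U`.
-/
theorem IsJordanChain.le_finrank [FiniteDimensional K U] {A B : U →ₗ[K] W} {c : K}
    (hc : Function.Bijective (A - c • B)) {n : ℕ} {e : ℕ → U} (he : IsJordanChain A B n e) :
    n ≤ Module.finrank K U := by
  let C : U ≃ₗ[K] W := LinearEquiv.ofBijective (A - c • B) hc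
  let T : Module.End K U := C.symm.toLinearMap ∘ₗ B
  have hC : ∀ x, A x = C x + c • B x := fun x => by simp [C]
  have hT : ∀ x, C (T x) = B x := fun x => by simp [T]
  have hT0 : T (e 0) = 0 := C.injective (by rw [hT, he.2.1, map_zero])
  have hstep : ∀ i < n, T (e (i + 1)) = e i + c • T (e i) := by
    intro i hi
    apply C.injective
    rw [hT, ← he.2.2 i hi, hC, map_add, map_smul, hT]
  have hpow : ∀ i ≤ n, (T ^ i) (e i) = e 0 := by
    intro i
    induction i with
    | zero => intro _; simp
    | succ i ih =>
      intro hi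
      have hi' := ih (by omega)
      rw [pow_succ, Module.End.mul_apply, hstep i (by omega), map_add, map_smul, hi',
        ← Module.End.mul_apply, ← pow_succ, pow_succ', Module.End.mul_apply, hi', hT0]
      simp
  by_contra hlt
  push Not at hlt
  have h1 : (T ^ (n + 1)) (e n) = 0 := by
    rw [pow_succ', Module.End.mul_apply, hpow n le_rfl, hT0]
  have h2 := Module.End.ker_pow_le_ker_pow_finrank T (n + 1) h1
  have h3 : (T ^ n) (e n) = 0 := by
    obtain ⟨k, hk⟩ := Nat.exists_eq_add_of_le hlt.le
    have hsplit : T ^ n = T ^ k * T ^ Module.finrank K U := by rw [← pow_add, hk, add_comm]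
    rw [hsplit, Module.End.mul_apply, h2, map_zero]
  exact he.1 (by rw [← hpow n le_rfl, h3])

/-- A Jordan chain of maximal length can be split off by means of functionals. -/
theorem exists_jordan_splitting [FiniteDimensional K U] (A B : U →ₗ[K] W) {c : K}
    (hc : Function.Bijective (A - c • B)) (hB : ¬ Function.Injective B) :
    ∃ (n : ℕ) (e : ℕ → U) (ψ : ℕ → Module.Dual K W),
      IsJordanChain A B n e ∧ (∀ i < n, ψ i ∘ₗ B = ψ (i + 1) ∘ₗ A) ∧ ψ n ∘ₗ B = 0 ∧
      ψ 0 (A (e 0)) ≠ 0 := by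
  classical
  have hex : ∃ n e, IsJordanChain A B n e := by
    rw [injective_iff_map_eq_zero] at hB
    push Not at hB
    obtain ⟨x, hx, hx0⟩ := hB
    exact ⟨0, fun _ => x, hx0, hx, by simp⟩
  let P : ℕ → Prop := fun n => ∃ e, IsJordanChain A B n e
  obtain ⟨n₀, hn₀⟩ : ∃ n, P n := hex
  have hbound : ∀ n, P n → n ≤ Module.finrank K U := fun n ⟨e, he⟩ => he.le_finrank hc
  obtain ⟨e, he⟩ : P (Nat.findGreatest P (Module.finrank K U)) :=
    Nat.findGreatest_spec (hbound _ hn₀) hn₀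
  have hmax : ∀ m, P m → m ≤ Nat.findGreatest P (Module.finrank K U) := fun m hm =>
    Nat.le_findGreatest (hbound m hm) hm
  generalize Nat.findGreatest P (Module.finrank K U) = n at he hmax
  have hnot : A (e 0) ∉ reach A B ⊤ (n + 1) := by
    rw [apply_mem_reach_iff]
    rintro ⟨e', h0, h1, -⟩
    have := hmax (n + 1) ⟨e', by rw [h0]; exact he.1, by rw [h0]; exact he.2.1, h1⟩
    omega
  -- Taking `D = ⊤` forces `ψ (n + 1) = 0`, whence `ψ n ∘ B = ψ (n + 1) ∘ A = 0`.
  obtain ⟨ψ, h0, h1, h2⟩ := exists_dual_chain_of_notMem A B ⊤ (n + 1) _ hnot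
  refine ⟨n, e, ψ, he, fun i hi => h1 i (by omega), ?_, h0⟩
  rw [h1 n (by omega)]
  ext x
  exact h2 _ trivial

end Chains

end JordanKronecker

namespace JordanKronecker

/-! ### Block forms and splitting by dual families -/

section BlockForm

variable {K U W : Type*} [Field K] [AddCommGroup U] [Module K U] [AddCommGroup W] [Module K W]

/-- The pencil `A + λ B` is block diagonal in suitable bases, with blocks indexed by any type. -/
def HasBlockForm {ι : Type} (blk : ι → Block K) (A B : U →ₗ[K] W) : Prop :=
  ∃ (bU : Module.Basis (Σ i, Fin (blk i).cols) K U) (bW : Module.Basis (Σ i, Fin (blk i).rows) K W),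
    (∀ i j, A (bU ⟨i, j⟩) = ∑ r : Fin (blk i).rows, (blk i).entryA r j • bW ⟨i, r⟩) ∧
    ∀ i j, B (bU ⟨i, j⟩) = ∑ r : Fin (blk i).rows, (blk i).entryB r j • bW ⟨i, r⟩

theorem toMatrix_eq_blockDiagonal'_iff {ι : Type*} [Fintype ι] [DecidableEq ι]
    {r c : ι → ℕ} (bU : Module.Basis (Σ i, Fin (c i)) K U) (bW : Module.Basis (Σ i, Fin (r i)) K W)
    (A : U →ₗ[K] W) (M : ∀ i, Matrix (Fin (r i)) (Fin (c i)) K) :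
    LinearMap.toMatrix bU bW A = Matrix.blockDiagonal' M ↔
      ∀ i j, A (bU ⟨i, j⟩) = ∑ s, M i s j • bW ⟨i, s⟩ := by
  have key : ∀ i j, ∑ p : Σ i, Fin (r i), Matrix.blockDiagonal' M p ⟨i, j⟩ • bW p =
      ∑ s, M i s j • bW ⟨i, s⟩ := by
    intro i j
    rw [Fintype.sum_sigma, Finset.sum_eq_single i]
    · simp
    · intro i' _ hi'
      refine Finset.sum_eq_zero fun s _ => ?_
      rw [Matrix.blockDiagonal'_apply_ne _ _ _ hi', zero_smul]
    · simp
  constructor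
  · intro h i j
    rw [← key, ← h]
    simp only [LinearMap.toMatrix_apply]
    exact (bW.sum_repr _).symm
  · intro h
    ext p ⟨i, j⟩
    rw [LinearMap.toMatrix_apply, h, ← key, bW.repr_sum_self]

theorem HasBlockForm.hasCanonicalForm {ι : Type} {k : ℕ} {blk : ι → Block K} {A B : U →ₗ[K] W}
    (h : HasBlockForm blk A B) (g : Fin k ≃ ι) : HasCanonicalForm A B (blk ∘ g) := by
  obtain ⟨bU, bW, hA, hB⟩ := h
  refine ⟨bU.reindex (Equiv.sigmaCongrLeft (β := fun i => Fin (blk i).cols) g).symm,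
    bW.reindex (Equiv.sigmaCongrLeft (β := fun i => Fin (blk i).rows) g).symm, ?_, ?_⟩
  · rw [toMatrix_eq_blockDiagonal'_iff]
    intro i j
    simpa [Equiv.sigmaCongrLeft, Block.matA] using hA (g i) j
  · rw [toMatrix_eq_blockDiagonal'_iff]
    intro i j
    simpa [Equiv.sigmaCongrLeft, Block.matB] using hB (g i) j

/-- A basis adapted to the splitting of a space by vectors and functionals in duality. -/
theorem exists_basis_of_dual {n : ℕ} {κ : Type*} (e : Fin n → U) (φ : Fin n → Module.Dual K U)
    (h : (Matrix.of fun i j => φ i (e j)).det ≠ 0)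
    (b : Module.Basis κ K (LinearMap.ker (LinearMap.pi φ))) :
    ∃ b' : Module.Basis (Fin n ⊕ κ) K U, (∀ j, b' (Sum.inl j) = e j) ∧
      ∀ x, b' (Sum.inr x) = b x := by
  classical
  set G : Matrix (Fin n) (Fin n) K := Matrix.of fun i j => φ i (e j) with hG
  let F : (Fin n → K) × LinearMap.ker (LinearMap.pi φ) →ₗ[K] U :=
    (Fintype.linearCombination K e).coprod (Submodule.subtype _)
  have hF : ∀ x y, F (x, y) = ∑ j, x j • e j + y := fun x y => by
    simp [F, Fintype.linearCombination_apply]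
  have hφ : ∀ x : Fin n → K, (LinearMap.pi φ) (∑ j, x j • e j) = G.mulVec x := by
    intro x
    ext i
    simp [hG, Matrix.mulVec, dotProduct, mul_comm]
  have hGu : IsUnit G.det := isUnit_iff_ne_zero.2 h
  have hbij : Function.Bijective F := by
    constructor
    · rw [injective_iff_map_eq_zero]
      rintro ⟨x, y⟩ hxy
      rw [hF] at hxy
      have h1 := congrArg (LinearMap.pi φ) hxy
      rw [map_add, hφ, y.2, add_zero, map_zero] at h1
      have hx : x = 0 := Matrix.eq_zero_of_mulVec_eq_zero h h1
      subst hx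
      have hy : y = 0 := by
        ext
        simpa using hxy
      simp [hy]
    · intro u
      -- The coefficients of the projection of `u` to the span of the `e j` along the common kernel
      -- of the `φ i`.
      let x := G⁻¹.mulVec (LinearMap.pi φ u)
      refine ⟨(x, ⟨u - ∑ j, x j • e j, ?_⟩), ?_⟩
      · rw [LinearMap.mem_ker, map_sub, hφ, Matrix.mulVec_mulVec, Matrix.mul_nonsing_inv _ hGu,
          Matrix.one_mulVec, sub_self]
      · rw [hF]
        simp
  refine ⟨((Pi.basisFun K (Fin n)).prod b).map (LinearEquiv.ofBijective F hbij), ?_, ?_⟩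
  · intro j
    simp [hF, Pi.single_apply]
  · intro x
    simp [hF]

/-- Splitting off one block from a pencil, by means of vectors and functionals in duality. -/
theorem hasBlockForm_of_split (b : Block K) {A B : U →ₗ[K] W} (e : Fin b.cols → U)
    (f : Fin b.rows → W) (φ : Fin b.cols → Module.Dual K U) (ψ : Fin b.rows → Module.Dual K W)
    (hAe : ∀ j, A (e j) = ∑ r : Fin b.rows, b.entryA r j • f r)
    (hBe : ∀ j, B (e j) = ∑ r : Fin b.rows, b.entryB r j • f r)
    (hU : (Matrix.of fun i j => φ i (e j)).det ≠ 0)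
    (hW : (Matrix.of fun i j => ψ i (f j)).det ≠ 0)
    (hA : ∀ x ∈ LinearMap.ker (LinearMap.pi φ), A x ∈ LinearMap.ker (LinearMap.pi ψ))
    (hB : ∀ x ∈ LinearMap.ker (LinearMap.pi φ), B x ∈ LinearMap.ker (LinearMap.pi ψ))
    {ι : Type} {blk : ι → Block K} (h : HasBlockForm blk (A.restrict hA) (B.restrict hB)) :
    HasBlockForm (Sum.elim (fun _ : Unit => b) blk) A B := by
  obtain ⟨bU, bW, h1, h2⟩ := h
  obtain ⟨cU, hcU, hcU'⟩ := exists_basis_of_dual e φ hU bU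
  obtain ⟨cW, hcW, hcW'⟩ := exists_basis_of_dual f ψ hW bW
  let eU : (Σ i : Unit ⊕ ι, Fin (Sum.elim (fun _ : Unit => b) blk i).cols) ≃
      (Fin b.cols ⊕ Σ i, Fin (blk i).cols) :=
    (Equiv.sumSigmaDistrib _).trans
      (Equiv.sumCongr (Equiv.uniqueSigma (fun _ : Unit => Fin b.cols)) (Equiv.refl _))
  let eW : (Σ i : Unit ⊕ ι, Fin (Sum.elim (fun _ : Unit => b) blk i).rows) ≃
      (Fin b.rows ⊕ Σ i, Fin (blk i).rows) :=
    (Equiv.sumSigmaDistrib _).trans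
      (Equiv.sumCongr (Equiv.uniqueSigma (fun _ : Unit => Fin b.rows)) (Equiv.refl _))
  have hUl : ∀ j, cU.reindex eU.symm ⟨Sum.inl (), j⟩ = e j := fun j => by
    rw [Module.Basis.reindex_apply, Equiv.symm_symm]; exact hcU j
  have hWl : ∀ j, cW.reindex eW.symm ⟨Sum.inl (), j⟩ = f j := fun j => by
    rw [Module.Basis.reindex_apply, Equiv.symm_symm]; exact hcW j
  have hUr : ∀ i j, cU.reindex eU.symm ⟨Sum.inr i, j⟩ = bU ⟨i, j⟩ := fun i j => by
    rw [Module.Basis.reindex_apply, Equiv.symm_symm]; exact hcU' ⟨i, j⟩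
  have hWr : ∀ i j, cW.reindex eW.symm ⟨Sum.inr i, j⟩ = bW ⟨i, j⟩ := fun i j => by
    rw [Module.Basis.reindex_apply, Equiv.symm_symm]; exact hcW' ⟨i, j⟩
  refine ⟨cU.reindex eU.symm, cW.reindex eW.symm, ?_, ?_⟩
  · rintro (⟨⟩ | i) j
    · rw [hUl]
      simp only [hWl]
      exact hAe j
    · rw [hUr]
      simp only [hWr]
      have h : A (bU ⟨i, j⟩) =
          ∑ r : Fin (blk i).rows, (blk i).entryA r j • (bW ⟨i, r⟩ : W) := by
        simpa using congrArg Subtype.val (h1 i j)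
      exact h
  · rintro (⟨⟩ | i) j
    · rw [hUl]
      simp only [hWl]
      exact hBe j
    · rw [hUr]
      simp only [hWr]
      have h : B (bU ⟨i, j⟩) =
          ∑ r : Fin (blk i).rows, (blk i).entryB r j • (bW ⟨i, r⟩ : W) := by
        simpa using congrArg Subtype.val (h2 i j)
      exact h

/-- A pencil has a direct summand isomorphic to a block. -/
def HasBlockSummand (A B : U →ₗ[K] W) (b : Block K) : Prop :=
  ∃ (e : Fin b.cols → U) (f : Fin b.rows → W) (φ : Fin b.cols → Module.Dual K U)
    (ψ : Fin b.rows → Module.Dual K W),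
    (∀ j, A (e j) = ∑ r : Fin b.rows, b.entryA r j • f r) ∧
    (∀ j, B (e j) = ∑ r : Fin b.rows, b.entryB r j • f r) ∧
    (∀ i, ψ i ∘ₗ A = ∑ j : Fin b.cols, b.entryA i j • φ j) ∧
    (∀ i, ψ i ∘ₗ B = ∑ j : Fin b.cols, b.entryB i j • φ j) ∧
    (Matrix.of fun i j => φ i (e j)).det ≠ 0 ∧ (Matrix.of fun i j => ψ i (f j)).det ≠ 0

/-- The determinant of a triangular Toeplitz matrix with nonzero diagonal does not vanish. -/
theorem det_toeplitz_ne_zero {n : ℕ} (g : ℕ → ℕ → K) (h0 : 0 < n → g 0 0 ≠ 0)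
    (hz : ∀ i, i + 1 < n → g (i + 1) 0 = 0)
    (hs : ∀ i j, i + 1 < n → j + 1 < n → g (i + 1) (j + 1) = g i j) :
    (Matrix.of fun i j : Fin n => g i j).det ≠ 0 := by
  have hd : ∀ i, i < n → g i i = g 0 0 := by
    intro i
    induction i with
    | zero => intro _; rfl
    | succ i ih => intro hi; rw [hs i i hi hi, ih (by omega)]
  have hl : ∀ j i, i < n → j < i → g i j = 0 := by
    intro j
    induction j with
    | zero =>
      intro i hi hij
      obtain ⟨i, rfl⟩ := Nat.exists_eq_succ_of_ne_zero hij.ne'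
      exact hz i hi
    | succ j ih =>
      intro i hi hij
      obtain ⟨i, rfl⟩ := Nat.exists_eq_succ_of_ne_zero (Nat.ne_of_gt (Nat.zero_lt_of_lt hij))
      rw [hs i j hi (by omega)]
      exact ih i (by omega) (by omega)
  have ht : (Matrix.of fun i j : Fin n => g i j).IsUpperTriangular :=
    fun i j hij => hl j i i.2 hij
  rw [Matrix.det_of_isUpperTriangular ht]
  refine Finset.prod_ne_zero_iff.2 fun i _ => ?_
  rw [Matrix.of_apply, hd i i.2]
  exact h0 (Nat.zero_lt_of_lt i.2)

theorem sum_ite_val_eq {M : Type*} [AddCommMonoid M] [Module K M] {n : ℕ} (j : ℕ) (f : ℕ → M) :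
    ∑ r : Fin n, (if (r : ℕ) = j then (1 : K) else 0) • f r = if j < n then f j else 0 := by
  split_ifs with h
  · rw [Finset.sum_eq_single ⟨j, h⟩]
    · simp
    · intro r _ hr
      rw [if_neg (fun h' => hr (Fin.ext h')), zero_smul]
    · simp
  · refine Finset.sum_eq_zero fun r _ => ?_
    rw [if_neg (by have := r.2; omega), zero_smul]

theorem sum_ite_val_succ_eq {M : Type*} [AddCommMonoid M] [Module K M] {n : ℕ} (j : ℕ)
    (f : ℕ → M) : ∑ r : Fin n, (if (r : ℕ) + 1 = j then (1 : K) else 0) • f r =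
      if 0 < j ∧ j ≤ n then f (j - 1) else 0 := by
  rcases j with _ | j
  · simp
  · simp only [Nat.add_right_cancel_iff, sum_ite_val_eq]
    congr 1
    simp

end BlockForm

end JordanKronecker

namespace JordanKronecker

/-! ### Splitting off a single block -/

section Summands

variable {K U W : Type*} [Field K] [AddCommGroup U] [Module K U] [AddCommGroup W] [Module K W]

theorem sum_ite_eq_val {M : Type*} [AddCommMonoid M] [Module K M] {n : ℕ} (j : ℕ) (f : ℕ → M) :
    ∑ r : Fin n, (if j = (r : ℕ) then (1 : K) else 0) • f r = if j < n then f j else 0 := by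
  rw [← sum_ite_val_eq (K := K)]
  simp only [eq_comm]

theorem sum_ite_eq_val_succ {M : Type*} [AddCommMonoid M] [Module K M] {n : ℕ} (j : ℕ)
    (f : ℕ → M) : ∑ r : Fin n, (if j = (r : ℕ) + 1 then (1 : K) else 0) • f r =
      if 0 < j ∧ j ≤ n then f (j - 1) else 0 := by
  rw [← sum_ite_val_succ_eq (K := K)]
  simp only [eq_comm]

/-- For a minimal singular chain the pairing is triangular Toeplitz: `φ (i+1) (e (j+1)) = ψ i (B (e
(j+1))) = ψ i (A (e j)) = φ i (e j)`, and `φ (i+1) (e 0) = ψ i (B (e 0)) = 0`. -/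
theorem exists_hasBlockSummand_horizontal {A B : U →ₗ[K] W}
    (h : ∃ n e, IsSingularChain A B n e) : ∃ n, HasBlockSummand A B (Block.horizontal n) := by
  obtain ⟨n, e, φ, ψ, ⟨-, he1, he2, he3⟩, hA, hB, h0⟩ := exists_singular_splitting A B h
  have hz : ∀ i, i + 1 < n + 1 → φ (i + 1) (e 0) = 0 := fun i hi => by
    rw [← hB i (by omega), LinearMap.comp_apply, he1, map_zero]
  have hs : ∀ i j, i + 1 < n + 1 → j + 1 < n + 1 → φ (i + 1) (e (j + 1)) = φ i (e j) := by
    intro i j hi hj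
    rw [← hB i (by omega), LinearMap.comp_apply, ← he2 j (by omega), ← hA i (by omega)]
    rfl
  refine ⟨n, fun j : Fin (n + 1) => e j, fun r : Fin n => A (e r), fun j : Fin (n + 1) => φ j,
    fun r : Fin n => ψ r, fun (j : Fin (n + 1)) => ?_, fun (j : Fin (n + 1)) => ?_,
    fun (i : Fin n) => ?_, fun (i : Fin n) => ?_, ?_, ?_⟩
  · change A (e j) = ∑ r : Fin n, (if (r : ℕ) = j then (1 : K) else 0) • A (e r)
    rw [sum_ite_val_eq (j : ℕ) fun r => A (e r)]
    split_ifs with hj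
    · rfl
    · rw [show (j : ℕ) = n by omega, he3]
  · change B (e j) = ∑ r : Fin n, (if (r : ℕ) + 1 = j then (1 : K) else 0) • A (e r)
    rw [sum_ite_val_succ_eq (j : ℕ) fun r => A (e r)]
    obtain ⟨j, hj⟩ := j
    rcases j with _ | j
    · simpa using he1
    · simp [he2 j (by omega), show j + 1 ≤ n by omega]
  · change ψ i ∘ₗ A = ∑ j : Fin (n + 1), (if (i : ℕ) = j then (1 : K) else 0) • φ j
    rw [sum_ite_eq_val (i : ℕ) φ, if_pos (by omega), hA i i.2]
  · change ψ i ∘ₗ B = ∑ j : Fin (n + 1), (if (i : ℕ) + 1 = j then (1 : K) else 0) • φ j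
    rw [sum_ite_eq_val ((i : ℕ) + 1) φ, if_pos (by omega), hB i i.2]
  · exact det_toeplitz_ne_zero (n := n + 1) (fun i j => φ i (e j)) (fun _ => h0) hz hs
  · have hW : (Matrix.of fun i j : Fin n => φ i (e j)).det ≠ 0 :=
      det_toeplitz_ne_zero (fun i j => φ i (e j)) (fun _ => h0)
        (fun i hi => hz i (by omega)) (fun i j hi hj => hs i j (by omega) (by omega))
    have heq : (Matrix.of fun i j : Fin n => ψ i (A (e j))) =
        Matrix.of fun i j : Fin n => φ i (e j) := by
      ext i j
      exact LinearMap.congr_fun (hA i i.2) (e j)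
    rw [← heq] at hW
    exact hW

/-- The horizontal argument for the transposed pencil: the chain `g` supplies the functionals, and
the splitting functionals on the dual spaces become vectors by biduality. -/
theorem exists_hasBlockSummand_vertical [FiniteDimensional K U] [FiniteDimensional K W]
    {A B : U →ₗ[K] W} (h : ∃ n g, IsSingularChain A.dualMap B.dualMap n g) :
    ∃ n, HasBlockSummand A B (Block.vertical n) := by
  obtain ⟨n, g, φ, ψ, ⟨-, hg1, hg2, hg3⟩, hA, hB, h0⟩ := exists_singular_splitting _ _ h
  obtain ⟨w, rfl⟩ : ∃ w : ℕ → W, φ = fun i => Module.evalEquiv K W (w i) :=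
    ⟨fun i => (Module.evalEquiv K W).symm (φ i), by simp⟩
  obtain ⟨u, rfl⟩ : ∃ u : ℕ → U, ψ = fun i => Module.evalEquiv K U (u i) :=
    ⟨fun i => (Module.evalEquiv K U).symm (ψ i), by simp⟩
  replace hA : ∀ i < n, A (u i) = w i := fun i hi =>
    (Module.evalEquiv K W).injective (by ext χ; simpa using LinearMap.congr_fun (hA i hi) χ)
  replace hB : ∀ i < n, B (u i) = w (i + 1) := fun i hi =>
    (Module.evalEquiv K W).injective (by ext χ; simpa using LinearMap.congr_fun (hB i hi) χ)
  replace h0 : g 0 (w 0) ≠ 0 := by simpa using h0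
  replace hg1 : g 0 ∘ₗ B = 0 := hg1
  replace hg2 : ∀ i < n, g i ∘ₗ A = g (i + 1) ∘ₗ B := hg2
  replace hg3 : g n ∘ₗ A = 0 := hg3
  have hz : ∀ i, i + 1 < n + 1 → g 0 (w (i + 1)) = 0 := fun i hi => by
    rw [← hB i (by omega)]
    exact LinearMap.congr_fun hg1 _
  have hs : ∀ i j, i + 1 < n + 1 → j + 1 < n + 1 → g (j + 1) (w (i + 1)) = g j (w i) := by
    intro i j hi hj
    rw [← hB i (by omega), ← hA i (by omega)]
    exact (LinearMap.congr_fun (hg2 j (by omega)) _).symm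
  refine ⟨n, fun j : Fin n => u j, fun r : Fin (n + 1) => w r, fun j : Fin n => g j ∘ₗ A,
    fun r : Fin (n + 1) => g r, fun (j : Fin n) => ?_, fun (j : Fin n) => ?_,
    fun (i : Fin (n + 1)) => ?_, fun (i : Fin (n + 1)) => ?_, ?_, ?_⟩
  · change A (u j) = ∑ r : Fin (n + 1), (if (r : ℕ) = j then (1 : K) else 0) • w r
    rw [sum_ite_val_eq (j : ℕ) w, if_pos (by omega), hA j j.2]
  · change B (u j) = ∑ r : Fin (n + 1), (if (r : ℕ) = j + 1 then (1 : K) else 0) • w r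
    rw [sum_ite_val_eq ((j : ℕ) + 1) w, if_pos (by omega), hB j j.2]
  · change g i ∘ₗ A = ∑ j : Fin n, (if (i : ℕ) = j then (1 : K) else 0) • (g j ∘ₗ A)
    rw [sum_ite_eq_val (i : ℕ) fun j => g j ∘ₗ A]
    split_ifs with hi
    · rfl
    · rw [show (i : ℕ) = n by omega, hg3]
  · change g i ∘ₗ B = ∑ j : Fin n, (if (i : ℕ) = j + 1 then (1 : K) else 0) • (g j ∘ₗ A)
    rw [sum_ite_eq_val_succ (i : ℕ) fun j => g j ∘ₗ A]
    obtain ⟨i, hi⟩ := i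
    rcases i with _ | i
    · simpa using hg1
    · simp [hg2 i (by omega), show i + 1 ≤ n by omega]
  · have hU : (Matrix.of fun i j : Fin n => g j (w i)).det ≠ 0 :=
      det_toeplitz_ne_zero (fun i j => g j (w i)) (fun _ => h0)
        (fun i hi => hz i (by omega)) (fun i j hi hj => hs i j (by omega) (by omega))
    have heq : (Matrix.of fun i j : Fin n => g i (A (u j))) =
        (Matrix.of fun i j : Fin n => g j (w i)).transpose := by
      ext i j
      exact congrArg (g i) (hA j j.2)
    rw [← Matrix.det_transpose, ← heq] at hU
    exact hU
  · have hW : (Matrix.of fun i j : Fin (n + 1) => g j (w i)).det ≠ 0 :=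
      det_toeplitz_ne_zero (fun i j => g j (w i)) (fun _ => h0) hz hs
    rw [← Matrix.det_transpose] at hW
    exact hW

theorem exists_hasBlockSummand_jordanInfty [FiniteDimensional K U] (A B : U →ₗ[K] W) {c : K}
    (hc : Function.Bijective (A - c • B)) (hB : ¬ Function.Injective B) :
    ∃ n, HasBlockSummand A B (Block.jordanInfty n) := by
  obtain ⟨n, e, ψ, ⟨-, he1, he2⟩, h1, h2, h0⟩ := exists_jordan_splitting A B hc hB
  have hdet : (Matrix.of fun i j : Fin (n + 1) => ψ i (A (e j))).det ≠ 0 := by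
    refine det_toeplitz_ne_zero (fun i j => ψ i (A (e j))) (fun _ => h0) ?_ ?_
    · intro i hi
      have := LinearMap.congr_fun (h1 i (by omega)) (e 0)
      simpa [he1] using this.symm
    · intro i j hi hj
      rw [he2 j (by omega)]
      exact (LinearMap.congr_fun (h1 i (by omega)) _).symm
  -- A chain indexed by `0, …, n` spans a block of size `n + 1`.
  refine ⟨n.succPNat, fun j : Fin (n + 1) => e j, fun r : Fin (n + 1) => A (e r),
    fun j : Fin (n + 1) => ψ j ∘ₗ A, fun r : Fin (n + 1) => ψ r,
    fun (j : Fin (n + 1)) => ?_, fun (j : Fin (n + 1)) => ?_,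
    fun (i : Fin (n + 1)) => ?_, fun (i : Fin (n + 1)) => ?_, hdet, hdet⟩
  · change A (e j) = ∑ r : Fin (n + 1), (if (r : ℕ) = j then (1 : K) else 0) • A (e r)
    rw [sum_ite_val_eq (j : ℕ) fun r => A (e r), if_pos j.2]
  · change B (e j) = ∑ r : Fin (n + 1), (if (r : ℕ) + 1 = j then (1 : K) else 0) • A (e r)
    rw [sum_ite_val_succ_eq (j : ℕ) fun r => A (e r)]
    obtain ⟨j, hj⟩ := j
    rcases j with _ | j
    · simpa using he1
    · simp [he2 j (by omega), show j ≤ n by omega]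
  · change ψ i ∘ₗ A = ∑ j : Fin (n + 1), (if (i : ℕ) = j then (1 : K) else 0) • (ψ j ∘ₗ A)
    rw [sum_ite_eq_val (i : ℕ) fun j => ψ j ∘ₗ A, if_pos i.2]
  · change ψ i ∘ₗ B = ∑ j : Fin (n + 1), (if (i : ℕ) + 1 = j then (1 : K) else 0) • (ψ j ∘ₗ A)
    rw [sum_ite_eq_val ((i : ℕ) + 1) fun j => ψ j ∘ₗ A]
    split_ifs with hi
    · exact h1 i (by omega)
    · rw [show (i : ℕ) = n by omega, h2]

/-- If `B` acts as the identity matrix and `A - c B` as the nilpotent shift, then `A` acts as `c`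
plus the shift. -/
theorem HasBlockSummand.jordan {A B : U →ₗ[K] W} {c : K} {n : ℕ+}
    (h : HasBlockSummand B (A - c • B) (Block.jordanInfty n)) :
    HasBlockSummand A B (Block.jordan c n) := by
  obtain ⟨e, f, φ, ψ, h1, h2, h3, h4, h5, h6⟩ := h
  have hentry : ∀ i j, (Block.jordan c n).entryA i j =
      c * (Block.jordanInfty n : Block K).entryA i j + (Block.jordanInfty n : Block K).entryB i j := by
    intro i j
    simp only [Block.entryA, Block.entryB]
    split_ifs <;> first | omega | simp
  refine ⟨e, f, φ, ψ, fun (j : Fin (Block.jordanInfty n : Block K).cols) => ?_, h1,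
    fun (i : Fin (Block.jordanInfty n : Block K).rows) => ?_, h3, h5, h6⟩
  · change A (e j) = ∑ r : Fin (Block.jordanInfty n : Block K).rows,
      (Block.jordan c n).entryA r j • f r
    have : A (e j) = c • B (e j) + (A - c • B) (e j) := by simp
    rw [this, h1, h2, Finset.smul_sum, ← Finset.sum_add_distrib]
    exact Finset.sum_congr rfl fun r _ => by rw [hentry, add_smul, mul_smul]
  · change ψ i ∘ₗ A = ∑ j : Fin (Block.jordanInfty n : Block K).cols,
      (Block.jordan c n).entryA i j • φ j
    have : ψ i ∘ₗ A = c • (ψ i ∘ₗ B) + ψ i ∘ₗ (A - c • B) := by ext; simp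
    rw [this, h3, h4, Finset.smul_sum, ← Finset.sum_add_distrib]
    exact Finset.sum_congr rfl fun r _ => by rw [hentry, add_smul, mul_smul]

/-- If `B` is singular, then `∞` is an eigenvalue. Otherwise take an eigenvalue `μ` of `B⁻¹ A` and
move it to infinity by passing to the pencil `B`, `A - μ B`. -/
theorem exists_hasBlockSummand_of_regular [IsAlgClosed K] [FiniteDimensional K U] [Nontrivial U]
    (A B : U →ₗ[K] W) {c : K} (hc : Function.Bijective (A - c • B)) :
    ∃ b, HasBlockSummand A B b := by
  by_cases hB : Function.Injective B
  · have e := LinearEquiv.ofBijective _ hc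
    have : FiniteDimensional K W := e.finiteDimensional
    have hB' : Function.Bijective B :=
      ⟨hB, (LinearMap.injective_iff_surjective_of_finrank_eq_finrank e.finrank_eq).1 hB⟩
    obtain ⟨μ, hμ⟩ := Module.End.exists_eigenvalue
      ((LinearEquiv.ofBijective B hB').symm.toLinearMap ∘ₗ A)
    obtain ⟨x, hx⟩ := hμ.exists_hasEigenvector
    have hx1 : A x = μ • B x := by
      have := congrArg (LinearEquiv.ofBijective B hB') hx.apply_eq_smul
      simpa using this
    obtain ⟨n, hn⟩ := exists_hasBlockSummand_jordanInfty B (A - μ • B) (c := 0) (by simpa using hB')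
      (fun hinj => hx.2 (hinj (by simp [hx1])))
    exact ⟨_, hn.jordan⟩
  · obtain ⟨n, hn⟩ := exists_hasBlockSummand_jordanInfty A B hc hB
    exact ⟨_, hn⟩

/-- The complement is the pair of common kernels of the `φ` and of the `ψ`. It is invariant because
each `ψ i ∘ A` and `ψ i ∘ B` is a combination of the `φ j`. The strict inequality drives the
induction on total dimension. -/
theorem HasBlockSummand.exists_complement {A B : U →ₗ[K] W} {b : Block K}
    [FiniteDimensional K U] [FiniteDimensional K W]
    (h : HasBlockSummand A B b) :
    ∃ (U' : Submodule K U) (W' : Submodule K W) (hA : ∀ x ∈ U', A x ∈ W')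
      (hB : ∀ x ∈ U', B x ∈ W'),
      Module.finrank K U' + Module.finrank K W' < Module.finrank K U + Module.finrank K W ∧
      ∀ {ι : Type} {blk : ι → Block K}, HasBlockForm blk (A.restrict hA) (B.restrict hB) →
        HasBlockForm (Sum.elim (fun _ : Unit => b) blk) A B := by
  obtain ⟨e, f, φ, ψ, h1, h2, h3, h4, h5, h6⟩ := h
  refine ⟨LinearMap.ker (LinearMap.pi φ), LinearMap.ker (LinearMap.pi ψ), ?_, ?_, ?_,
    fun h => hasBlockForm_of_split b e f φ ψ h1 h2 h5 h6 _ _ h⟩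
  · intro x hx
    ext i
    have hx' : ∀ j, φ j x = 0 := fun j => congrFun hx j
    simpa [hx'] using LinearMap.congr_fun (h3 i) x
  · intro x hx
    ext i
    have hx' : ∀ j, φ j x = 0 := fun j => congrFun hx j
    simpa [hx'] using LinearMap.congr_fun (h4 i) x
  · obtain ⟨bU, -⟩ := exists_basis_of_dual e φ h5 (Module.finBasis K _)
    obtain ⟨bW, -⟩ := exists_basis_of_dual f ψ h6 (Module.finBasis K _)
    rw [Module.finrank_eq_card_basis bU, Module.finrank_eq_card_basis bW]
    simp only [Fintype.card_sum, Fintype.card_fin]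
    have : 0 < b.cols + b.rows := by
      cases b with
      | jordan c n => exact Nat.add_pos_left n.pos _
      | jordanInfty n => exact Nat.add_pos_left n.pos _
      | horizontal n => simp [Block.cols, Block.rows]
      | vertical n => simp [Block.cols, Block.rows]
    omega

end Summands

end JordanKronecker

namespace JordanKronecker

/-! ### Kronecker's canonical form -/

section Existence

universe u v

variable {K : Type*} [Field K]

open Polynomial in
/-- A square pencil all of whose members are singular has a singular chain. -/
theorem exists_isSingularChain_of_finrank_eq {U W : Type*} [AddCommGroup U] [Module K U]
    [AddCommGroup W] [Module K W] [FiniteDimensional K U] [FiniteDimensional K W] [Infinite K]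
    {A B : U →ₗ[K] W} (hd : Module.finrank K U = Module.finrank K W)
    (h : ∀ c : K, ¬ Function.Injective (A - c • B)) : ∃ n e, IsSingularChain A B n e := by
  let bU := Module.finBasis K U
  let bW := (Module.finBasis K W).reindex (finCongr hd.symm)
  let MA := LinearMap.toMatrix bU bW A
  let MB := LinearMap.toMatrix bU bW B
  let M : Matrix (Fin (Module.finrank K U)) (Fin (Module.finrank K U)) K[X] :=
    MA.map C - (X : K[X]) • MB.map C
  have hM : ∀ c : K, M.map (eval c) = LinearMap.toMatrix bU bW (A - c • B) := by
    intro c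
    ext i j
    simp [M, MA, MB]
    exact mul_comm _ _
  -- A polynomial vanishing on an infinite field is zero, so `A - X B` has a kernel vector with
  -- polynomial entries; its coefficients form the chain.
  have hdet : M.det = 0 := by
    refine Polynomial.funext fun c => ?_
    have h1 : eval c M.det = (M.map (eval c)).det := (evalRingHom c).map_det M
    rw [h1, hM, eval_zero]
    have h2 := h c
    rw [injective_iff_map_eq_zero] at h2
    push Not at h2
    obtain ⟨x, hx, hx0⟩ := h2
    rw [← Matrix.exists_mulVec_eq_zero_iff]
    refine ⟨bU.repr x, fun h0 => hx0 ?_, ?_⟩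
    · rw [← bU.repr.map_eq_zero_iff]
      exact DFunLike.coe_injective h0
    · rw [LinearMap.toMatrix_mulVec_repr, hx, map_zero]
      rfl
  obtain ⟨v, hv0, hv⟩ := Matrix.exists_mulVec_eq_zero_iff.2 hdet
  let V : ℕ → U := fun k => ∑ j, (v j).coeff k • bU j
  have hrepr : ∀ (T : U →ₗ[K] W) k i,
      bW.repr (T (V k)) i = ∑ j, LinearMap.toMatrix bU bW T i j * (v j).coeff k := by
    intro T k i
    simp [V, LinearMap.toMatrix_apply, mul_comm]
  have hrow : ∀ i, ∑ j, (C (MA i j) * v j) = X * ∑ j, C (MB i j) * v j := by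
    intro i
    have := congrFun hv i
    simp only [M, Matrix.mulVec, dotProduct, Matrix.sub_apply, Matrix.smul_apply, Matrix.map_apply,
      Pi.zero_apply, sub_mul, Finset.sum_sub_distrib, sub_eq_zero, smul_eq_mul] at this
    rw [this, Finset.mul_sum]
    exact Finset.sum_congr rfl fun j _ => mul_assoc _ _ _
  have hA0 : A (V 0) = 0 := by
    apply bW.repr.injective
    ext i
    have := congrArg (coeff · 0) (hrow i)
    simpa [hrepr, MA] using this
  have hAB : ∀ k, A (V (k + 1)) = B (V k) := by
    intro k
    apply bW.repr.injective
    ext i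
    have := congrArg (coeff · (k + 1)) (hrow i)
    simpa [hrepr, MA, MB, coeff_X_mul] using this
  -- The search starts at a coefficient known to be nonzero, since `V 0` may vanish; `N` is then the
  -- end of a run of nonzero coefficients.
  obtain ⟨N, hN, hN1⟩ : ∃ N, V N ≠ 0 ∧ V (N + 1) = 0 := by
    by_contra! hcon
    obtain ⟨j, hj⟩ := Function.ne_iff.1 hv0
    have hst : V (v j).natDegree ≠ 0 := by
      intro h0
      have := congrArg (fun x => bU.repr x j) h0
      simp [V, Finsupp.single_apply] at this
      exact hj this
    have hall : ∀ k ≥ (v j).natDegree, V k ≠ 0 := fun k hk =>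
      Nat.le_induction hst (fun k _ hk => hcon k hk) k hk
    refine hall ((v j).natDegree + ∑ i, ((v i).natDegree + 1)) (Nat.le_add_right _ _) ?_
    refine Finset.sum_eq_zero fun i _ => ?_
    rw [coeff_eq_zero_of_natDegree_lt, zero_smul]
    have := Finset.single_le_sum (f := fun i => (v i).natDegree + 1) (fun i _ => Nat.zero_le _)
      (Finset.mem_univ i)
    omega
  -- Reversed, because a singular chain starts at the vector killed by `B`.
  refine ⟨N, fun k => V (N - k), hN, ?_, fun i hi => ?_, by simpa using hA0⟩
  · change B (V (N - 0)) = 0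
    rw [Nat.sub_zero, ← hAB, hN1, map_zero]
  · change A (V (N - i)) = B (V (N - (i + 1)))
    rw [show N - i = N - (i + 1) + 1 by omega, hAB]

/-- A pencil with more columns than rows has a singular chain. -/
theorem exists_isSingularChain_of_finrank_lt {U W : Type*} [AddCommGroup U] [Module K U]
    [AddCommGroup W] [Module K W] [FiniteDimensional K U] [FiniteDimensional K W] [Infinite K]
    (A B : U →ₗ[K] W) (hd : Module.finrank K W < Module.finrank K U) :
    ∃ n e, IsSingularChain A B n e := by
  -- Padding by zero rows makes the pencil square, with every member still singular.
  let ι : W →ₗ[K] W × (Fin (Module.finrank K U - Module.finrank K W) → K) := LinearMap.inl K _ _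
  have hι : Function.Injective ι := LinearMap.inl_injective
  obtain ⟨n, e, h0, h1, h2, h3⟩ := exists_isSingularChain_of_finrank_eq (A := ι ∘ₗ A) (B := ι ∘ₗ B)
    (by rw [Module.finrank_prod, Module.finrank_fin_fun]; omega) (fun c hinj => by
      have hinj' : Function.Injective (A - c • B) := by
        refine Function.Injective.of_comp (f := ι) ?_
        convert hinj using 1
        ext x <;> simp
      exact absurd (LinearMap.finrank_le_finrank_of_injective hinj') (by omega))
  exact ⟨n, e, h0, hι (by simpa using h1), fun i hi => hι (h2 i hi), hι (by simpa using h3)⟩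

variable [IsAlgClosed K]

theorem exists_hasBlockSummand {U W : Type*} [AddCommGroup U] [Module K U]
    [AddCommGroup W] [Module K W] [FiniteDimensional K U] [FiniteDimensional K W]
    (A B : U →ₗ[K] W) (h : 0 < Module.finrank K U + Module.finrank K W) :
    ∃ b, HasBlockSummand A B b := by
  have : Infinite K := IsAlgClosed.instInfinite
  rcases lt_trichotomy (Module.finrank K U) (Module.finrank K W) with hd | hd | hd
  · obtain ⟨n, hn⟩ := exists_hasBlockSummand_vertical (A := A) (B := B)
      (exists_isSingularChain_of_finrank_lt A.dualMap B.dualMap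
        (by rwa [Subspace.dual_finrank_eq, Subspace.dual_finrank_eq]))
    exact ⟨_, hn⟩
  · by_cases hs : ∀ c : K, ¬ Function.Injective (A - c • B)
    · obtain ⟨n, hn⟩ := exists_hasBlockSummand_horizontal
        (exists_isSingularChain_of_finrank_eq hd hs)
      exact ⟨_, hn⟩
    · push Not at hs
      obtain ⟨c, hc⟩ := hs
      have : Nontrivial U := Module.finrank_pos_iff (R := K).1 (by omega)
      exact exists_hasBlockSummand_of_regular A B
        ⟨hc, (LinearMap.injective_iff_surjective_of_finrank_eq_finrank hd).1 hc⟩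
  · obtain ⟨n, hn⟩ := exists_hasBlockSummand_horizontal
      (exists_isSingularChain_of_finrank_lt A B hd)
    exact ⟨_, hn⟩

theorem exists_hasBlockForm (n : ℕ) {U : Type u} {W : Type v} [AddCommGroup U] [Module K U]
    [AddCommGroup W] [Module K W] [FiniteDimensional K U] [FiniteDimensional K W]
    (A B : U →ₗ[K] W) (hn : Module.finrank K U + Module.finrank K W = n) :
    ∃ (ι : Type) (_ : Finite ι) (blk : ι → Block K), HasBlockForm blk A B := by
  induction n using Nat.strong_induction_on generalizing U W with
  | _ n ih =>
    subst hn
    rcases Nat.eq_zero_or_pos (Module.finrank K U + Module.finrank K W) with h0 | hpos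
    · have hU : Subsingleton U := Module.finrank_zero_iff (R := K).1 (by omega)
      have hW : Subsingleton W := Module.finrank_zero_iff (R := K).1 (by omega)
      exact ⟨Empty, inferInstance, Empty.elim, Module.Basis.empty _, Module.Basis.empty _,
        fun i => i.elim, fun i => i.elim⟩
    · obtain ⟨b, hb⟩ := exists_hasBlockSummand A B hpos
      obtain ⟨U', W', hA, hB, hlt, hext⟩ := hb.exists_complement
      obtain ⟨ι, hι, blk, hblk⟩ := ih _ hlt (A.restrict hA) (B.restrict hB) rfl
      exact ⟨Unit ⊕ ι, inferInstance, _, hext hblk⟩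

/-- **Kronecker's theorem** on the canonical form of a pencil of linear maps. -/
theorem exists_hasCanonicalForm {U : Type u} {W : Type v} [AddCommGroup U] [Module K U]
    [AddCommGroup W] [Module K W] [FiniteDimensional K U] [FiniteDimensional K W]
    (A B : U →ₗ[K] W) : ∃ (k : ℕ) (blk : Fin k → Block K), HasCanonicalForm A B blk := by
  obtain ⟨ι, hι, blk, h⟩ := exists_hasBlockForm _ A B rfl
  exact ⟨_, _, h.hasCanonicalForm (Finite.equivFin ι).symm⟩

end Existence

end JordanKronecker

namespace JordanKronecker

/-! ### Polynomial functions and algebraic conditions -/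

section PolynomialConditions

variable {K ι : Type*} [Field K]

/-- A function on an affine space is polynomial. -/
def IsPolyFun (F : (ι → K) → K) : Prop :=
  ∃ p : MvPolynomial ι K, ∀ w, MvPolynomial.eval w p = F w

theorem IsPolyFun.const (c : K) : IsPolyFun (fun _ : ι → K => c) :=
  ⟨MvPolynomial.C c, fun w => by simp⟩

theorem IsPolyFun.coord (i : ι) : IsPolyFun (fun w : ι → K => w i) :=
  ⟨MvPolynomial.X i, fun w => by simp⟩

theorem IsPolyFun.sub {F G : (ι → K) → K} (hF : IsPolyFun F) (hG : IsPolyFun G) :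
    IsPolyFun fun w => F w - G w := by
  obtain ⟨p, hp⟩ := hF
  obtain ⟨q, hq⟩ := hG
  exact ⟨p - q, fun w => by simp [hp, hq]⟩

theorem IsPolyFun.mul {F G : (ι → K) → K} (hF : IsPolyFun F) (hG : IsPolyFun G) :
    IsPolyFun fun w => F w * G w := by
  obtain ⟨p, hp⟩ := hF
  obtain ⟨q, hq⟩ := hG
  exact ⟨p * q, fun w => by simp [hp, hq]⟩

theorem IsPolyFun.sum {α : Type*} (s : Finset α) {F : α → (ι → K) → K}
    (hF : ∀ a, IsPolyFun (F a)) : IsPolyFun fun w => ∑ a ∈ s, F a w := by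
  choose p hp using hF
  exact ⟨∑ a ∈ s, p a, fun w => by simp [hp]⟩

theorem IsPolyFun.prod {α : Type*} (s : Finset α) {F : α → (ι → K) → K}
    (hF : ∀ a, IsPolyFun (F a)) : IsPolyFun fun w => ∏ a ∈ s, F a w := by
  choose p hp using hF
  exact ⟨∏ a ∈ s, p a, fun w => by simp [hp]⟩

theorem IsPolyFun.matrix_mul {l m n : Type*} [Fintype m] {M : (ι → K) → Matrix l m K}
    {N : (ι → K) → Matrix m n K} (hM : ∀ i j, IsPolyFun fun w => M w i j)
    (hN : ∀ i j, IsPolyFun fun w => N w i j) (i : l) (j : n) :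
    IsPolyFun fun w => (M w * N w) i j := by
  simp only [Matrix.mul_apply]
  exact .sum _ fun k => (hM i k).mul (hN k j)

/-- A condition on the points of an affine space is given by polynomial equations. -/
def IsAlgebraicCond (Z : (ι → K) → Prop) : Prop :=
  ∃ S : Set (MvPolynomial ι K), ∀ w, Z w ↔ ∀ p ∈ S, MvPolynomial.eval w p = 0

theorem IsAlgebraicCond.and {Z Z' : (ι → K) → Prop} (h : IsAlgebraicCond Z)
    (h' : IsAlgebraicCond Z') : IsAlgebraicCond fun w => Z w ∧ Z' w := by
  obtain ⟨S, hS⟩ := h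
  obtain ⟨S', hS'⟩ := h'
  refine ⟨S ∪ S', fun w => ?_⟩
  change Z w ∧ Z' w ↔ _
  rw [hS, hS']
  constructor
  · rintro ⟨h1, h2⟩ p (hp | hp)
    exacts [h1 p hp, h2 p hp]
  · intro h
    exact ⟨fun p hp => h p (Or.inl hp), fun p hp => h p (Or.inr hp)⟩

theorem IsPolyFun.eq {F G : (ι → K) → K} (hF : IsPolyFun F) (hG : IsPolyFun G) :
    IsAlgebraicCond fun w => F w = G w := by
  obtain ⟨p, hp⟩ := hF.sub hG
  exact ⟨{p}, fun w => by simp [hp, sub_eq_zero]⟩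

theorem IsAlgebraicCond.matrix_eq {m n : Type*} {M N : (ι → K) → Matrix m n K}
    (hM : ∀ i j, IsPolyFun fun w => M w i j) (hN : ∀ i j, IsPolyFun fun w => N w i j) :
    IsAlgebraicCond fun w => M w = N w := by
  choose p hp using fun ij : m × n => (hM ij.1 ij.2).sub (hN ij.1 ij.2)
  refine ⟨Set.range p, fun w => ?_⟩
  simp only [Set.forall_mem_range, hp, sub_eq_zero, Prod.forall]
  exact ⟨fun h i j => by rw [h], fun h => by ext i j; exact h i j⟩

theorem exists_generic_of_cover_cond [IsAlgClosed K] {σ ι : Type*} [Finite σ] [Finite ι]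
    {τ : ι → Type*} [∀ i, Finite (τ i)] {Z : ∀ i, (σ ⊕ τ i → K) → Prop}
    (hZ : ∀ i, IsAlgebraicCond (Z i))
    (hcover : ∀ x : σ → K, ∃ i, ∃ y : τ i → K, Z i (Sum.elim x y)) :
    ∃ i, ∃ f : MvPolynomial σ K, f ≠ 0 ∧ ∀ x, MvPolynomial.eval x f ≠ 0 →
      ∃ y : τ i → K, Z i (Sum.elim x y) := by
  choose S hS using hZ
  simp only [hS] at hcover ⊢
  exact exists_generic_of_cover S hcover

end PolynomialConditions

/-! ### Skeletons: canonical forms with labelled eigenvalues -/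

section Skeleton

namespace Block

/-- The block with the eigenvalue replaced by its image under a map. -/
def map {α β : Type*} (g : α → β) : Block α → Block β
  | jordan c n => jordan (g c) n
  | jordanInfty n => jordanInfty n
  | horizontal ε => horizontal ε
  | vertical η => vertical η

theorem rows_map {α β : Type*} (g : α → β) (b : Block α) : (b.map g).rows = b.rows := by
  cases b <;> rfl

theorem cols_map {α β : Type*} (g : α → β) (b : Block α) : (b.map g).cols = b.cols := by
  cases b <;> rfl

theorem rows_add_cols_pos {α : Type*} (b : Block α) : 0 < b.rows + b.cols := by
  cases b with
  | jordan c n => exact Nat.add_pos_left n.pos _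
  | jordanInfty n => exact Nat.add_pos_left n.pos _
  | horizontal n => simp [cols, rows]
  | vertical n => simp [cols, rows]

theorem jordanData?_map {α β : Type*} (g : α → β) (b : Block α) :
    (b.map g).jordanData? = b.jordanData?.map (Prod.map (OnePoint.map g) id) := by
  cases b <;> rfl

theorem columnIndex?_map {α β : Type*} (g : α → β) (b : Block α) :
    (b.map g).columnIndex? = b.columnIndex? := by
  cases b <;> rfl

theorem rowIndex?_map {α β : Type*} (g : α → β) (b : Block α) :
    (b.map g).rowIndex? = b.rowIndex? := by
  cases b <;> rfl

theorem finite_bounded {α : Type*} [Finite α] (N : ℕ) :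
    {b : Block α | b.rows + b.cols ≤ N}.Finite := by
  refine ((((Set.finite_range fun p : α × Fin (N + 1) => jordan p.1 (p.2 : ℕ).succPNat).union
    (Set.finite_range fun n : Fin (N + 1) => jordanInfty (n : ℕ).succPNat)).union
    (Set.finite_range fun n : Fin (N + 1) => horizontal (n : ℕ))).union
    (Set.finite_range fun n : Fin (N + 1) => vertical (n : ℕ))).subset ?_
  rintro (⟨c, n⟩ | n | n | n) h <;> simp only [Set.mem_ofPred_eq, rows, cols] at h
  · exact Or.inl (Or.inl (Or.inl ⟨(c, ⟨n.natPred, by have := n.natPred_add_one; omega⟩),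
      by simp⟩))
  · exact Or.inl (Or.inl (Or.inr ⟨⟨n.natPred, by have := n.natPred_add_one; omega⟩, by simp⟩))
  · exact Or.inl (Or.inr ⟨⟨n, by omega⟩, rfl⟩)
  · exact Or.inr ⟨⟨n, by omega⟩, rfl⟩

theorem isPolyFun_entryA {K ι α : Type*} [Field K] (e : (ι → K) → α → K)
    (he : ∀ a, IsPolyFun fun w => e w a) (b : Block α) (i j : ℕ) :
    IsPolyFun fun w => (b.map (e w)).entryA i j := by
  cases b with
  | jordan a n =>
    simp only [map, entryA]
    split_ifs
    exacts [he a, .const 1, .const 0]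
  | _ => exact .const _

theorem isPolyFun_entryB {K ι α : Type*} [Field K] (e : (ι → K) → α → K)
    (b : Block α) (i j : ℕ) : IsPolyFun fun w => (b.map (e w)).entryB i j := by
  cases b <;> exact .const _

end Block

/-- The type only records which eigenvalues coincide; an injective relabelling neither merges nor
splits them. -/
theorem AlgebraicType.ofBlocks_map {α β : Type*} {g : α → β} (hg : Function.Injective g)
    (s : Multiset (Block α)) : ofBlocks (s.map (Block.map g)) = ofBlocks s := by
  classical
  have hg' : Function.Injective (OnePoint.map g : OnePoint α → OnePoint β) :=
    Option.map_injective hg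
  have hJ : (s.map (Block.map g)).filterMap Block.jordanData? =
      (s.filterMap Block.jordanData?).map (Prod.map (OnePoint.map g) id) := by
    rw [Multiset.filterMap_map, Multiset.map_filterMap]
    congr 1
    funext b
    exact Block.jordanData?_map g b
  have hC : (s.map (Block.map g)).filterMap Block.columnIndex? =
      s.filterMap Block.columnIndex? := by
    rw [Multiset.filterMap_map]
    congr 1
    funext b
    exact Block.columnIndex?_map g b
  have hR : (s.map (Block.map g)).filterMap Block.rowIndex? =
      s.filterMap Block.rowIndex? := by
    rw [Multiset.filterMap_map]
    congr 1
    funext b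
    exact Block.rowIndex?_map g b
  unfold ofBlocks
  rw [hJ, hC, hR]
  congr 1
  generalize s.filterMap Block.jordanData? = t
  have h1 : (t.map (Prod.map (OnePoint.map g) id)).map Prod.fst =
      (t.map Prod.fst).map (OnePoint.map g : OnePoint α → OnePoint β) := by
    rw [Multiset.map_map, Multiset.map_map]
    rfl
  rw [h1, Multiset.dedup_map_of_injective hg', Multiset.map_map]
  refine Multiset.map_congr rfl fun x _ => ?_
  rw [Function.comp_apply, Multiset.filter_map, Multiset.map_map]
  refine congrArg₂ Multiset.map rfl (Multiset.filter_congr fun d _ => ?_)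
  exact hg'.eq_iff

variable {K U W : Type*} [Field K] [AddCommGroup U] [Module K U] [AddCommGroup W] [Module K W]

/-- Frees the index types of the bases from the eigenvalues, so that these can become variables of
polynomial equations. -/
theorem hasCanonicalForm_iff {k : ℕ} (blk : Fin k → Block K) {r c : Fin k → ℕ}
    (hr : ∀ i, (blk i).rows = r i) (hc : ∀ i, (blk i).cols = c i) (A B : U →ₗ[K] W) :
    HasCanonicalForm A B blk ↔
      ∃ (bU : Module.Basis (Σ i, Fin (c i)) K U) (bW : Module.Basis (Σ i, Fin (r i)) K W),
        LinearMap.toMatrix bU bW A =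
          Matrix.blockDiagonal' (fun i =>
            Matrix.of fun (a : Fin (r i)) (b : Fin (c i)) => (blk i).entryA a b) ∧
        LinearMap.toMatrix bU bW B =
          Matrix.blockDiagonal' (fun i =>
            Matrix.of fun (a : Fin (r i)) (b : Fin (c i)) => (blk i).entryB a b) := by
  obtain rfl : (fun i => (blk i).rows) = r := funext hr
  obtain rfl : (fun i => (blk i).cols) = c := funext hc
  exact Iff.rfl

theorem HasCanonicalForm.sum_cols {k : ℕ} {blk : Fin k → Block K} {A B : U →ₗ[K] W}
    (h : HasCanonicalForm A B blk) : ∑ i, (blk i).cols = Module.finrank K U := by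
  obtain ⟨bU, -, -⟩ := h
  rw [Module.finrank_eq_card_basis bU]
  simp

theorem HasCanonicalForm.sum_rows {k : ℕ} {blk : Fin k → Block K} {A B : U →ₗ[K] W}
    (h : HasCanonicalForm A B blk) : ∑ i, (blk i).rows = Module.finrank K W := by
  obtain ⟨-, bW, -⟩ := h
  rw [Module.finrank_eq_card_basis bW]
  simp

/-- A canonical form has a skeleton with a bounded number of blocks of bounded size, with
eigenvalues replaced by labels. -/
theorem HasCanonicalForm.exists_skeleton [Infinite K] {k N : ℕ} {blk : Fin k → Block K}
    {A B : U →ₗ[K] W} (h : HasCanonicalForm A B blk)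
    (hN : Module.finrank K W + Module.finrank K U = N) :
    k ≤ N ∧ ∃ (s : Fin k → Block (Fin N)) (e : Fin N → K), Function.Injective e ∧
      (∀ i, (s i).rows + (s i).cols ≤ N) ∧ blk = fun i => (s i).map e := by
  classical
  have hsum : ∑ i, ((blk i).rows + (blk i).cols) = N := by
    rw [Finset.sum_add_distrib, h.sum_rows, h.sum_cols, hN]
  have hk : k ≤ N := by
    rw [← hsum]
    calc k = ∑ _i : Fin k, 1 := by simp
      _ ≤ _ := Finset.sum_le_sum fun i _ => (blk i).rows_add_cols_pos
  let ev : Fin k → K := fun i => match blk i with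
    | .jordan c _ => c
    | _ => 0
  obtain ⟨E, hE, hcard⟩ := Infinite.exists_superset_card_eq (Finset.univ.image ev) N
    (Finset.card_image_le.trans (by simpa using hk))
  let e : Fin N ≃ E := (E.equivFinOfCardEq hcard).symm
  have hs : ∀ i, ∃ b : Block (Fin N), b.map (fun a => (e a : K)) = blk i := by
    intro i
    have hi : ev i ∈ E := hE (Finset.mem_image_of_mem _ (Finset.mem_univ i))
    rcases hb : blk i with ⟨c, n⟩ | n | n | n
    · have hc : c ∈ E := by simpa [ev, hb] using hi
      exact ⟨.jordan (e.symm ⟨c, hc⟩) n, by simp [Block.map]⟩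
    · exact ⟨.jordanInfty n, rfl⟩
    · exact ⟨.horizontal n, rfl⟩
    · exact ⟨.vertical n, rfl⟩
  choose s hs using hs
  refine ⟨hk, s, fun a => e a, Subtype.val_injective.comp e.injective, fun i => ?_,
    funext fun i => (hs i).symm⟩
  rw [← (s i).rows_map fun a => (e a : K), ← (s i).cols_map fun a => (e a : K), hs, ← hsum]
  exact Finset.single_le_sum (f := fun i => (blk i).rows + (blk i).cols)
    (fun i _ => Nat.zero_le _) (Finset.mem_univ i)

end Skeleton

end JordanKronecker

namespace JordanKronecker

/-! ### Generic constancy of the algebraic type -/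

section GenericType

variable {K : Type*} [Field K]

/-- The block diagonal matrix of the maps `A` of the blocks of a skeleton, for given eigenvalues. -/
noncomputable def skeletonA {k N : ℕ} (s : Fin k → Block (Fin N)) (e : Fin N → K) :
    Matrix (Σ i, Fin (s i).rows) (Σ i, Fin (s i).cols) K :=
  Matrix.blockDiagonal' fun i =>
    Matrix.of fun (a : Fin (s i).rows) (b : Fin (s i).cols) => ((s i).map e).entryA a b

/-- The block diagonal matrix of the maps `B` of the blocks of a skeleton, for given eigenvalues. -/
noncomputable def skeletonB {k N : ℕ} (s : Fin k → Block (Fin N)) (e : Fin N → K) :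
    Matrix (Σ i, Fin (s i).rows) (Σ i, Fin (s i).cols) K :=
  Matrix.blockDiagonal' fun i =>
    Matrix.of fun (a : Fin (s i).rows) (b : Fin (s i).cols) => ((s i).map e).entryB a b

theorem isPolyFun_blockDiagonal' {ι : Type*} {k : ℕ} {r c : Fin k → ℕ}
    {M : (ι → K) → ∀ i, Matrix (Fin (r i)) (Fin (c i)) K}
    (hM : ∀ i a b, IsPolyFun fun w => M w i a b) (p q) :
    IsPolyFun fun w => Matrix.blockDiagonal' (M w) p q := by
  obtain ⟨i, a⟩ := p
  obtain ⟨j, b⟩ := q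
  by_cases h : i = j
  · subst h
    simpa only [Matrix.blockDiagonal'_apply_eq] using hM i a b
  · simpa only [Matrix.blockDiagonal'_apply_ne _ _ _ h] using IsPolyFun.const 0

variable {U W : Type*} [AddCommGroup U] [Module K U] [AddCommGroup W] [Module K W]

/-- Treating the inverse matrices as further unknowns makes the change of bases a system of
polynomial equations. -/
theorem hasCanonicalForm_map_iff {k N : ℕ} (s : Fin k → Block (Fin N)) (e : Fin N → K)
    {m n : Type*} [Fintype m] [DecidableEq m] [Fintype n] [DecidableEq n]
    (cU : Module.Basis n K U) (cW : Module.Basis m K W) (A B : U →ₗ[K] W) :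
    HasCanonicalForm A B (fun i => (s i).map e) ↔
      ∃ (Q : Matrix n (Σ i, Fin (s i).cols) K) (Q' : Matrix (Σ i, Fin (s i).cols) n K)
        (P : Matrix m (Σ i, Fin (s i).rows) K) (P' : Matrix (Σ i, Fin (s i).rows) m K),
        Q * Q' = 1 ∧ Q' * Q = 1 ∧ P * P' = 1 ∧ P' * P = 1 ∧
        P' * LinearMap.toMatrix cU cW A * Q = skeletonA s e ∧
        P' * LinearMap.toMatrix cU cW B * Q = skeletonB s e := by
  rw [hasCanonicalForm_iff _ (fun i => (s i).rows_map e) (fun i => (s i).cols_map e)]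
  constructor
  · rintro ⟨bU, bW, hA, hB⟩
    refine ⟨cU.toMatrix bU, bU.toMatrix cU, cW.toMatrix bW, bW.toMatrix cW,
      cU.toMatrix_mul_toMatrix_flip bU, bU.toMatrix_mul_toMatrix_flip cU,
      cW.toMatrix_mul_toMatrix_flip bW, bW.toMatrix_mul_toMatrix_flip cW, ?_, ?_⟩
    · rw [basis_toMatrix_mul_linearMap_toMatrix_mul_basis_toMatrix, hA]
      rfl
    · rw [basis_toMatrix_mul_linearMap_toMatrix_mul_basis_toMatrix, hB]
      rfl
  · rintro ⟨Q, Q', P, P', h1, h2, h3, h4, hA, hB⟩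
    let bU : Module.Basis (Σ i, Fin (s i).cols) K U :=
      (Pi.basisFun K _).map (Matrix.toLinOfInv (Pi.basisFun K _) cU h1 h2)
    let bW : Module.Basis (Σ i, Fin (s i).rows) K W :=
      (Pi.basisFun K _).map (Matrix.toLinOfInv (Pi.basisFun K _) cW h3 h4)
    have hQ : cU.toMatrix bU = Q := by
      have hb : ∀ p, bU p = Matrix.toLin (Pi.basisFun K _) cU Q (Pi.basisFun K _ p) := fun p => by
        rw [Module.Basis.map_apply]
        rfl
      ext i j
      rw [Module.Basis.toMatrix_apply, hb, Matrix.toLin_self]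
      simp [Finsupp.single_apply]
    have hP : cW.toMatrix bW = P := by
      have hb : ∀ p, bW p = Matrix.toLin (Pi.basisFun K _) cW P (Pi.basisFun K _ p) := fun p => by
        rw [Module.Basis.map_apply]
        rfl
      ext i j
      rw [Module.Basis.toMatrix_apply, hb, Matrix.toLin_self]
      simp [Finsupp.single_apply]
    have hP' : bW.toMatrix cW = P' := by
      have h5 := bW.toMatrix_mul_toMatrix_flip cW
      rw [hP] at h5
      calc bW.toMatrix cW = bW.toMatrix cW * (P * P') := by rw [h3, Matrix.mul_one]
        _ = P' := by rw [← Matrix.mul_assoc, h5, Matrix.one_mul]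
    refine ⟨bU, bW, ?_, ?_⟩
    · rw [← basis_toMatrix_mul_linearMap_toMatrix_mul_basis_toMatrix bU cU bW cW, hQ, hP', hA]
      rfl
    · rw [← basis_toMatrix_mul_linearMap_toMatrix_mul_basis_toMatrix bU cU bW cW, hQ, hP', hB]
      rfl

/-- The product of the differences of the members of a finite sequence. -/
def distinctProd {N : ℕ} (e : Fin N → K) : K :=
  ∏ i, ∏ j, if i = j then 1 else e i - e j

/-- Rabinowitsch's trick: distinctness of the eigenvalues becomes an equation in one more variable.
-/
theorem injective_iff_exists_mul_distinctProd {N : ℕ} (e : Fin N → K) :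
    Function.Injective e ↔ ∃ z, z * distinctProd e = 1 := by
  have h : (∃ z, z * distinctProd e = 1) ↔ distinctProd e ≠ 0 :=
    ⟨fun ⟨z, hz⟩ h0 => by simp [h0] at hz, fun h0 => ⟨_, inv_mul_cancel₀ h0⟩⟩
  rw [h, distinctProd]
  simp only [Finset.prod_ne_zero_iff, Finset.mem_univ, true_implies]
  constructor
  · intro he i j
    split_ifs with hij
    · exact one_ne_zero
    · exact sub_ne_zero.2 fun h => hij (he h)
  · intro h i j hij
    by_contra hne
    simpa [hne, sub_eq_zero, hij] using h i j

theorem isPolyFun_distinctProd {ι : Type*} {N : ℕ} {e : (ι → K) → Fin N → K}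
    (he : ∀ i, IsPolyFun fun w => e w i) : IsPolyFun fun w => distinctProd (e w) := by
  refine .prod _ fun i => .prod _ fun j => ?_
  split_ifs
  exacts [.const 1, (he i).sub (he j)]

/-- The auxiliary variables of the polynomial equations saying that a pencil has a canonical form
with a given skeleton: the matrices of the bases, their inverses, the eigenvalues, and the inverse
of the product of the differences of the eigenvalues. -/
abbrev SkeletonVars (m n : Type) {k N : ℕ} (s : Fin k → Block (Fin N)) : Type :=
  (n × (Σ i, Fin (s i).cols)) ⊕ ((Σ i, Fin (s i).cols) × n) ⊕
    (m × (Σ i, Fin (s i).rows)) ⊕ ((Σ i, Fin (s i).rows) × m) ⊕ Fin N ⊕ Unit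

section Cond

variable {σ m n : Type} [Fintype m] [DecidableEq m] [Fintype n] [DecidableEq n] {k N : ℕ}
  (s : Fin k → Block (Fin N))

/-- The equations, in the point `x` and the auxiliary variables, saying that the pencil `M x`,
`M' x` has a canonical form with skeleton `s`. -/
def SkeletonCond (M M' : (σ → K) → Matrix m n K) (w : σ ⊕ SkeletonVars m n s → K) : Prop :=
  let Q : Matrix n (Σ i, Fin (s i).cols) K := Matrix.of fun a p => w (.inr (.inl (a, p)))
  let Q' : Matrix (Σ i, Fin (s i).cols) n K := Matrix.of fun p a => w (.inr (.inr (.inl (p, a))))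
  let P : Matrix m (Σ i, Fin (s i).rows) K :=
    Matrix.of fun a p => w (.inr (.inr (.inr (.inl (a, p)))))
  let P' : Matrix (Σ i, Fin (s i).rows) m K :=
    Matrix.of fun p a => w (.inr (.inr (.inr (.inr (.inl (p, a))))))
  let e : Fin N → K := fun j => w (.inr (.inr (.inr (.inr (.inr (.inl j))))))
  let x : σ → K := fun i => w (.inl i)
  (Q * Q' = 1 ∧ Q' * Q = 1 ∧ P * P' = 1 ∧ P' * P = 1 ∧
    P' * M x * Q = skeletonA s e ∧ P' * M' x * Q = skeletonB s e) ∧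
  w (.inr (.inr (.inr (.inr (.inr (.inr ())))))) * distinctProd e = 1

theorem isPolyFun_one_apply {ι l : Type*} [DecidableEq l] (i j : l) :
    IsPolyFun fun _ : ι → K => (1 : Matrix l l K) i j :=
  .const _

theorem isAlgebraicCond_skeletonCond {M M' : (σ → K) → Matrix m n K}
    (hM : ∀ i j, IsPolyFun fun w : σ ⊕ SkeletonVars m n s → K => M (fun i => w (.inl i)) i j)
    (hM' : ∀ i j, IsPolyFun fun w : σ ⊕ SkeletonVars m n s → K => M' (fun i => w (.inl i)) i j) :
    IsAlgebraicCond (SkeletonCond s M M') := by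
  refine .and (.and (.matrix_eq ?_ isPolyFun_one_apply) (.and (.matrix_eq ?_ isPolyFun_one_apply)
    (.and (.matrix_eq ?_ isPolyFun_one_apply) (.and (.matrix_eq ?_ isPolyFun_one_apply)
    (.and (.matrix_eq ?_ ?_) (.matrix_eq ?_ ?_)))))) (IsPolyFun.eq (.mul (.coord _) ?_) (.const 1))
  · exact .matrix_mul (fun _ _ => .coord _) (fun _ _ => .coord _)
  · exact .matrix_mul (fun _ _ => .coord _) (fun _ _ => .coord _)
  · exact .matrix_mul (fun _ _ => .coord _) (fun _ _ => .coord _)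
  · exact .matrix_mul (fun _ _ => .coord _) (fun _ _ => .coord _)
  · exact .matrix_mul (.matrix_mul (fun _ _ => .coord _) hM) (fun _ _ => .coord _)
  · exact isPolyFun_blockDiagonal' fun i a b =>
      Block.isPolyFun_entryA _ (fun _ => .coord _) (s i) a b
  · exact .matrix_mul (.matrix_mul (fun _ _ => .coord _) hM') (fun _ _ => .coord _)
  · exact isPolyFun_blockDiagonal' fun i a b => Block.isPolyFun_entryB _ (s i) a b
  · exact isPolyFun_distinctProd fun _ => .coord _

theorem exists_skeletonCond_iff (cU : Module.Basis n K U) (cW : Module.Basis m K W)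
    (A B : (σ → K) → (U →ₗ[K] W)) (x : σ → K) :
    (∃ y, SkeletonCond s (fun x => LinearMap.toMatrix cU cW (A x))
      (fun x => LinearMap.toMatrix cU cW (B x)) (Sum.elim x y)) ↔
    ∃ e : Fin N → K, Function.Injective e ∧
      HasCanonicalForm (A x) (B x) (fun i => (s i).map e) := by
  simp only [hasCanonicalForm_map_iff s _ cU cW, injective_iff_exists_mul_distinctProd]
  constructor
  · rintro ⟨y, h, hz⟩
    exact ⟨_, ⟨_, hz⟩, _, _, _, _, h⟩
  · rintro ⟨e, ⟨z, hz⟩, Q, Q', P, P', h⟩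
    exact ⟨Sum.elim (fun p => Q p.1 p.2) (Sum.elim (fun p => Q' p.1 p.2)
      (Sum.elim (fun p => P p.1 p.2) (Sum.elim (fun p => P' p.1 p.2)
      (Sum.elim e fun _ => z)))), h, hz⟩

end Cond

/-- In a linear family of pencils the algebraic type is constant on the complement of a
hypersurface. -/
theorem exists_generic_algebraicType [IsAlgClosed K] [FiniteDimensional K U]
    [FiniteDimensional K W] {σ : Type} [Fintype σ] (A B : (σ → K) →ₗ[K] U →ₗ[K] W) :
    ∃ (T : AlgebraicType) (f : MvPolynomial σ K), f ≠ 0 ∧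
      ∀ x, MvPolynomial.eval x f ≠ 0 → HasAlgebraicType (A x) (B x) T := by
  classical
  have : Infinite K := IsAlgClosed.instInfinite
  obtain ⟨N, hN⟩ : ∃ N, Module.finrank K W + Module.finrank K U = N := ⟨_, rfl⟩
  let cU := Module.finBasis K U
  let cW := Module.finBasis K W
  have hpoly : ∀ (A : (σ → K) →ₗ[K] U →ₗ[K] W) (τ : Type) i j,
      IsPolyFun fun w : σ ⊕ τ → K => LinearMap.toMatrix cU cW (A fun i => w (.inl i)) i j := by
    intro A τ i j
    have : (fun w : σ ⊕ τ → K => LinearMap.toMatrix cU cW (A fun i => w (.inl i)) i j) =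
        fun w => ∑ a, w (.inl a) * LinearMap.toMatrix cU cW (A (Pi.single a 1)) i j := by
      funext w
      have hx : (fun i => w (.inl i) : σ → K) = ∑ a, w (.inl a) • Pi.single a (1 : K) := by
        ext i
        simp [Pi.single_apply]
      rw [hx]
      simp [Matrix.sum_apply]
    rw [this]
    exact .sum _ fun a => .mul (.coord _) (.const _)
  -- Finitely many skeletons suffice for all members of the family, which the covering argument
  -- requires.
  have : Finite {b : Block (Fin N) // b.rows + b.cols ≤ N} := Block.finite_bounded N
  obtain ⟨⟨k, s⟩, f, hf, h⟩ := exists_generic_of_cover_cond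
    (ι := Σ k : Fin (N + 1), Fin k → {b : Block (Fin N) // b.rows + b.cols ≤ N})
    (fun t => isAlgebraicCond_skeletonCond (fun i => (t.2 i).1)
      (hpoly A _) (hpoly B _)) (fun x => by
        obtain ⟨k, blk, hblk⟩ := exists_hasCanonicalForm (A x) (B x)
        obtain ⟨hk, s, e, he, hs, rfl⟩ := hblk.exists_skeleton hN
        exact ⟨⟨⟨k, by omega⟩, fun i => ⟨s i, hs i⟩⟩,
          (exists_skeletonCond_iff s cU cW (A ·) (B ·) x).2 ⟨e, he, hblk⟩⟩)
  refine ⟨AlgebraicType.ofBlocks (Finset.univ.val.map fun i => (s i).1), f, hf, fun x hx => ?_⟩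
  obtain ⟨e, he, hform⟩ :=
    (exists_skeletonCond_iff (fun i => (s i).1) cU cW (A ·) (B ·) x).1 (h x hx)
  refine ⟨_, _, hform, ?_⟩
  rw [← AlgebraicType.ofBlocks_map he, Multiset.map_map]
  rfl

end GenericType

end JordanKronecker

namespace JordanKronecker

/-! ### Kernel dimensions and the number of Kronecker blocks -/

section Counting

namespace Block

variable {K : Type*} [Field K]

/-- The number, `0` or `1`, of minimal column indices contributed by a block. -/
def colDefect {α : Type*} (b : Block α) : ℕ := b.columnIndex?.elim 0 fun _ => 1

/-- The number, `0` or `1`, of minimal row indices contributed by a block. -/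
def rowDefect {α : Type*} (b : Block α) : ℕ := b.rowIndex?.elim 0 fun _ => 1

theorem rows_add_colDefect {α : Type*} (b : Block α) :
    b.rows + b.colDefect = b.cols + b.rowDefect := by
  cases b <;> rfl

theorem finrank_ker_eq_zero_of_det_ne_zero {n : ℕ} {M : Matrix (Fin n) (Fin n) K}
    (h : M.det ≠ 0) : Module.finrank K (LinearMap.ker M.mulVecLin) = 0 := by
  rw [LinearMap.ker_eq_bot'.2 fun x hx => Matrix.eq_zero_of_mulVec_eq_zero h hx, finrank_bot]

/-- Without its last column the matrix is unitriangular, so the map is onto and rank-nullity leaves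
a line. -/
theorem finrank_ker_horizontal (ε : ℕ) (c : K) :
    Module.finrank K (LinearMap.ker
      ((horizontal ε : Block K).matA + c • (horizontal ε : Block K).matB).mulVecLin) = 1 := by
  let M : Matrix (Fin ε) (Fin (ε + 1)) K :=
    Matrix.of fun i j => (if (i : ℕ) = j then 1 else 0) + c * (if (i : ℕ) + 1 = j then 1 else 0)
  let G : Matrix (Fin ε) (Fin ε) K := M.submatrix id Fin.castSucc
  have hGt : G.IsUpperTriangular := fun i j (hij : j < i) => by
    have hij' : (j : ℕ) < i := hij
    simp only [G, M, Matrix.submatrix_apply, Matrix.of_apply, id, Fin.val_castSucc]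
    rw [if_neg (by omega), if_neg (by omega)]
    simp
  have hG : IsUnit G.det := by
    rw [Matrix.det_of_isUpperTriangular hGt]
    simp [G, M]
  have hsurj : LinearMap.range M.mulVecLin = ⊤ := by
    rw [LinearMap.range_eq_top]
    intro y
    refine ⟨Fin.snoc (α := fun _ => K) (G⁻¹.mulVec y) 0, ?_⟩
    have h1 : M.mulVec (Fin.snoc (α := fun _ => K) (G⁻¹.mulVec y) 0) =
        G.mulVec (G⁻¹.mulVec y) := by
      ext i
      simp [Matrix.mulVec, dotProduct, Fin.sum_univ_castSucc, G]
    rw [Matrix.mulVecLin_apply, h1, Matrix.mulVec_mulVec, Matrix.mul_nonsing_inv _ hG,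
      Matrix.one_mulVec]
  have h := M.mulVecLin.finrank_range_add_finrank_ker
  rw [hsurj, finrank_top, Module.finrank_fin_fun, Module.finrank_fin_fun] at h
  change Module.finrank K (LinearMap.ker M.mulVecLin) = 1
  omega

theorem finrank_ker_vertical (η : ℕ) (c : K) :
    Module.finrank K (LinearMap.ker
      ((vertical η : Block K).matA + c • (vertical η : Block K).matB).mulVecLin) = 0 := by
  let M : Matrix (Fin (η + 1)) (Fin η) K :=
    Matrix.of fun i j => (if (i : ℕ) = j then 1 else 0) + c * (if (i : ℕ) = j + 1 then 1 else 0)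
  let G : Matrix (Fin η) (Fin η) K := M.submatrix Fin.castSucc id
  have hGt : G.IsLowerTriangular := fun i j (hij : i < j) => by
    have hij' : (i : ℕ) < j := hij
    simp only [G, M, Matrix.submatrix_apply, Matrix.of_apply, id, Fin.val_castSucc]
    rw [if_neg (by omega), if_neg (by omega)]
    simp
  have hG : G.det ≠ 0 := by
    rw [Matrix.det_of_isLowerTriangular G hGt]
    simp [G, M]
  change Module.finrank K (LinearMap.ker M.mulVecLin) = 0
  rw [LinearMap.ker_eq_bot'.2 fun x hx => Matrix.eq_zero_of_mulVec_eq_zero hG ?_, finrank_bot]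
  ext i
  exact congrFun hx i.castSucc

theorem finrank_ker_jordanInfty (n : ℕ+) (c : K) :
    Module.finrank K (LinearMap.ker
      ((jordanInfty n : Block K).matA + c • (jordanInfty n : Block K).matB).mulVecLin) = 0 := by
  let M : Matrix (Fin n) (Fin n) K :=
    Matrix.of fun i j => (if (i : ℕ) = j then 1 else 0) + c * (if (i : ℕ) + 1 = j then 1 else 0)
  have ht : M.IsUpperTriangular := fun i j (hij : j < i) => by
    have hij' : (j : ℕ) < i := hij
    simp only [M, Matrix.of_apply]
    rw [if_neg (by omega), if_neg (by omega)]
    simp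
  refine finrank_ker_eq_zero_of_det_ne_zero (M := M) ?_
  rw [Matrix.det_of_isUpperTriangular ht]
  simp [M]

theorem finrank_ker_jordan (e : K) (n : ℕ+) {c : K} (hc : e + c ≠ 0) :
    Module.finrank K (LinearMap.ker
      ((jordan e n : Block K).matA + c • (jordan e n : Block K).matB).mulVecLin) = 0 := by
  let M : Matrix (Fin n) (Fin n) K :=
    Matrix.of fun i j => (if (i : ℕ) = j then e else if (i : ℕ) + 1 = j then 1 else 0) + c * (if (i : ℕ) = j then 1 else 0)
  have ht : M.IsUpperTriangular := fun i j (hij : j < i) => by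
    have hij' : (j : ℕ) < i := hij
    simp only [M, Matrix.of_apply]
    rw [if_neg (by omega), if_neg (by omega), if_neg (by omega)]
    simp
  refine finrank_ker_eq_zero_of_det_ne_zero (M := M) ?_
  rw [Matrix.det_of_isUpperTriangular ht]
  simp [M, hc]

theorem colDefect_le_finrank_ker (b : Block K) (c : K) :
    b.colDefect ≤ Module.finrank K (LinearMap.ker (b.matA + c • b.matB).mulVecLin) := by
  cases b with
  | horizontal ε => exact (finrank_ker_horizontal ε c).ge
  | _ => exact Nat.zero_le _

theorem finite_finrank_ker_ne (b : Block K) :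
    {c : K | Module.finrank K (LinearMap.ker (b.matA + c • b.matB).mulVecLin) ≠
      b.colDefect}.Finite := by
  cases b with
  | jordan e n =>
    refine (Set.finite_singleton (-e)).subset fun c hc => ?_
    by_contra hne
    exact hc (finrank_ker_jordan e n fun h => hne (eq_neg_of_add_eq_zero_right h))
  | jordanInfty n => simp [finrank_ker_jordanInfty, colDefect, columnIndex?]
  | horizontal ε => simp [finrank_ker_horizontal, colDefect, columnIndex?]
  | vertical η => simp [finrank_ker_vertical, colDefect, columnIndex?]

end Block

variable {K U W : Type*} [Field K] [AddCommGroup U] [Module K U] [AddCommGroup W] [Module K W]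

theorem finrank_ker_of_toMatrix_eq_blockDiagonal' {k : ℕ} {r c : Fin k → ℕ}
    (bU : Module.Basis (Σ i, Fin (c i)) K U) (bW : Module.Basis (Σ i, Fin (r i)) K W)
    (A : U →ₗ[K] W) (M : ∀ i, Matrix (Fin (r i)) (Fin (c i)) K)
    (h : LinearMap.toMatrix bU bW A = Matrix.blockDiagonal' M) :
    Module.finrank K (LinearMap.ker A) =
      ∑ i, Module.finrank K (LinearMap.ker (M i).mulVecLin) := by
  have hrepr : ∀ u i a, bW.repr (A u) ⟨i, a⟩ = (M i).mulVec (fun j => bU.repr u ⟨i, j⟩) a := by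
    intro u i a
    rw [← LinearMap.toMatrix_mulVec_repr bU bW A u, h, Matrix.mulVec, dotProduct,
      Fintype.sum_sigma, Finset.sum_eq_single i]
    · simp [Matrix.mulVec, dotProduct]
    · intro i' _ hi'
      refine Finset.sum_eq_zero fun s _ => ?_
      rw [Matrix.blockDiagonal'_apply_ne _ _ _ hi'.symm, zero_mul]
    · simp
  let F : LinearMap.ker A →ₗ[K] ∀ i, LinearMap.ker (M i).mulVecLin :=
    LinearMap.pi fun i => LinearMap.codRestrict _
      ((LinearMap.pi fun j => bU.coord ⟨i, j⟩) ∘ₗ Submodule.subtype _) fun u => by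
        rw [LinearMap.mem_ker, Matrix.mulVecLin_apply]
        ext a
        have h1 := hrepr u i a
        rw [u.2] at h1
        rw [map_zero, Finsupp.zero_apply] at h1
        exact h1.symm
  have hF : Function.Bijective F := by
    constructor
    · intro u v huv
      apply Subtype.ext
      apply bU.repr.injective
      ext ⟨i, j⟩
      exact congrFun (congrArg Subtype.val (congrFun huv i)) j
    · intro y
      let u := bU.equivFun.symm fun p => (y p.1 : Fin (c p.1) → K) p.2
      have hu : ∀ i j, bU.repr u ⟨i, j⟩ = (y i : Fin (c i) → K) j := fun i j => by
        rw [← bU.equivFun_apply, LinearEquiv.apply_symm_apply]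
      have huA : A u = 0 := by
        apply bW.repr.injective
        ext ⟨i, a⟩
        rw [hrepr]
        simp only [hu]
        rw [map_zero]
        exact congrFun (y i).2 a
      refine ⟨⟨u, huA⟩, ?_⟩
      funext i
      apply Subtype.ext
      funext j
      exact hu i j
  rw [(LinearEquiv.ofBijective F hF).finrank_eq, Module.finrank_pi_fintype]

theorem card_filterMap_eq_sum {α β : Type*} (f : α → Option β) (s : Multiset α) :
    Multiset.card (s.filterMap f) = (s.map fun a => (f a).elim 0 fun _ => 1).sum := by
  induction s using Multiset.induction_on with
  | empty => rfl
  | cons a s ih =>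
    rcases h : f a with _ | b
    · rw [Multiset.filterMap_cons_none _ _ h]
      simp [h, ih]
    · rw [Multiset.filterMap_cons_some _ _ _ h]
      simp [h, ih, add_comm]

/-- Describes the block counts through kernel dimensions alone, so no uniqueness of the canonical
form is needed later. It also serves as semicontinuity of the kernel dimension along a line. -/
theorem HasAlgebraicType.card_minColumnIndices {A B : U →ₗ[K] W} {T : AlgebraicType}
    (h : HasAlgebraicType A B T) :
    Module.finrank K W + Multiset.card T.minColumnIndices =
        Module.finrank K U + Multiset.card T.minRowIndices ∧
      (∀ c : K, Multiset.card T.minColumnIndices ≤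
        Module.finrank K (LinearMap.ker (A + c • B))) ∧
      {c : K | Module.finrank K (LinearMap.ker (A + c • B)) ≠
        Multiset.card T.minColumnIndices}.Finite := by
  obtain ⟨k, blk, hform, rfl⟩ := h
  have hp : Multiset.card (AlgebraicType.ofBlocks (Finset.univ.val.map blk)).minColumnIndices =
      ∑ i, (blk i).colDefect := by
    simp only [AlgebraicType.ofBlocks, card_filterMap_eq_sum, Multiset.map_map]
    rfl
  have hq : Multiset.card (AlgebraicType.ofBlocks (Finset.univ.val.map blk)).minRowIndices =
      ∑ i, (blk i).rowDefect := by
    simp only [AlgebraicType.ofBlocks, card_filterMap_eq_sum, Multiset.map_map]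
    rfl
  have hker : ∀ c : K, Module.finrank K (LinearMap.ker (A + c • B)) =
      ∑ i, Module.finrank K (LinearMap.ker ((blk i).matA + c • (blk i).matB).mulVecLin) := by
    intro c
    obtain ⟨bU, bW, hA, hB⟩ := hform
    refine finrank_ker_of_toMatrix_eq_blockDiagonal' bU bW _
      (fun i => (blk i).matA + c • (blk i).matB) ?_
    rw [map_add, map_smul, hA, hB, ← Matrix.blockDiagonal'_smul, ← Matrix.blockDiagonal'_add]
    rfl
  rw [hp, hq]
  refine ⟨?_, fun c => ?_, ?_⟩
  · rw [← hform.sum_rows, ← hform.sum_cols, ← Finset.sum_add_distrib, ← Finset.sum_add_distrib]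
    exact Finset.sum_congr rfl fun i _ => (blk i).rows_add_colDefect
  · rw [hker]
    exact Finset.sum_le_sum fun i _ => (blk i).colDefect_le_finrank_ker c
  · refine (Set.finite_iUnion fun i => (blk i).finite_finrank_ker_ne).subset fun c hc => ?_
    by_contra hnot
    simp only [Set.mem_iUnion, not_exists] at hnot
    refine hc ?_
    rw [hker]
    exact Finset.sum_congr rfl fun i _ => not_not.1 (hnot i)

/-- A defining polynomial not vanishing at `w` restricts to a nonzero polynomial in one variable on
the line, which has finitely many roots. -/
theorem IsZariskiOpen.finite_line_notMem {S : Set W} (hS : IsZariskiOpen K S) {w : W} (hw : w ∈ S)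
    (v : W) : {t : K | w + t • v ∉ S}.Finite := by
  obtain ⟨P, hP⟩ := hS
  have hmem : ∀ z, z ∉ S ↔ ∀ p ∈ P, MvPolynomial.eval (fun φ : Module.Dual K W => φ z) p = 0 :=
    fun z => Set.ext_iff.1 hP z
  obtain ⟨p, hp, hpw⟩ : ∃ p ∈ P, MvPolynomial.eval (fun φ : Module.Dual K W => φ w) p ≠ 0 := by
    by_contra! hcon
    exact (hmem w).2 hcon hw
  let q : Polynomial K := MvPolynomial.aeval
    (fun φ : Module.Dual K W => Polynomial.C (φ w) + Polynomial.X * Polynomial.C (φ v)) p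
  have hq : ∀ t, q.eval t = MvPolynomial.eval (fun φ : Module.Dual K W => φ (w + t • v)) p := by
    intro t
    have h1 : (Polynomial.aeval t) q = MvPolynomial.aeval
        (fun φ : Module.Dual K W => φ (w + t • v)) p := by
      have h2 : ∀ φ : Module.Dual K W, Polynomial.aeval t
          (Polynomial.C (φ w) + Polynomial.X * Polynomial.C (φ v)) = φ (w + t • v) := fun φ => by
        simpa using mul_comm _ _
      rw [← AlgHom.comp_apply, MvPolynomial.comp_aeval]
      simp only [h2]
    rw [← Polynomial.coe_aeval_eq_eval, h1]
    rfl
  have hq0 : q ≠ 0 := fun h => hpw (by simpa [h] using (hq 0).symm)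
  refine (q.finite_setOfPred_isRoot hq0).subset fun t ht => ?_
  change q.eval t = 0
  rw [hq]
  exact (hmem _).1 ht p hp

end Counting

/-! ### Generic pairs and regular points of a representation -/

section Representation

variable {K 𝔤 V : Type*} [Field K] [LieRing 𝔤] [LieAlgebra K 𝔤] [AddCommGroup V] [Module K V]

theorem R_add_smul (ρ : 𝔤 →ₗ⁅K⁆ Module.End K V) (x y : V) (c : K) :
    R ρ (x + c • y) = R ρ x + c • R ρ y := by
  simp [R]

variable [IsAlgClosed K] [FiniteDimensional K 𝔤] [FiniteDimensional K V]

theorem exists_isJordanKroneckerInvariant (ρ : 𝔤 →ₗ⁅K⁆ Module.End K V) :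
    ∃ T, IsJordanKroneckerInvariant ρ T := by
  have : Infinite K := IsAlgClosed.instInfinite
  let b := Module.finBasis K (V × V)
  let L : V →ₗ[K] 𝔤 →ₗ[K] V := LinearMap.flip (ρ : 𝔤 →ₗ[K] V →ₗ[K] V)
  obtain ⟨T, f, hf, hT⟩ := exists_generic_algebraicType
    (L ∘ₗ LinearMap.fst K V V ∘ₗ b.equivFun.symm.toLinearMap)
    (L ∘ₗ LinearMap.snd K V V ∘ₗ b.equivFun.symm.toLinearMap)
  have hT' : ∀ p : V × V, MvPolynomial.eval (b.equivFun p) f ≠ 0 →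
      HasAlgebraicType (R ρ p.1) (R ρ p.2) T := fun p hp => by
    simpa [L, R] using hT _ hp
  obtain ⟨x, hx⟩ : ∃ x, MvPolynomial.eval x f ≠ 0 := by
    by_contra! hcon
    exact hf (MvPolynomial.funext fun x => by rw [hcon, map_zero])
  have hx' : MvPolynomial.eval (b.equivFun (b.equivFun.symm x)) f ≠ 0 := by
    rwa [LinearEquiv.apply_symm_apply]
  -- Renaming the variables to coordinate functionals puts the hypersurface in the form required by
  -- `IsZariskiOpen`.
  refine ⟨T, (b.equivFun.symm x).1, (b.equivFun.symm x).2,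
    ⟨{p | MvPolynomial.eval (b.equivFun p) f ≠ 0}, ⟨{MvPolynomial.rename b.coord f}, ?_⟩, hx', T,
      hT'⟩, hT' _ hx'⟩
  ext p
  simp only [Set.mem_compl_iff, Set.mem_ofPred_eq, not_not, Set.mem_singleton_iff, forall_eq,
    MvPolynomial.eval_rename]
  rfl

/-- A Zariski open set contains, with a pair `(x, a)`, also a pair `(y, a)` with `y` regular. -/
theorem exists_isRegular_mem (ρ : 𝔤 →ₗ⁅K⁆ Module.End K V) {S : Set (V × V)}
    (hS : IsZariskiOpen K S) {x a : V} (hxa : (x, a) ∈ S) : ∃ y, IsRegular ρ y ∧ (y, a) ∈ S := by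
  have : Infinite K := IsAlgClosed.instInfinite
  obtain ⟨r, hr⟩ := exists_isRegular ρ
  -- This pencil parametrises the line from `x` at `t = 0` to the regular point `r` at `t = 1`. For
  -- all but finitely many `t` the stabiliser is no larger than that of `r`, and the pair stays in
  -- `S`.
  obtain ⟨k, blk, hform⟩ := exists_hasCanonicalForm (R ρ x) (R ρ (r - x))
  obtain ⟨-, hle, hfin⟩ := HasAlgebraicType.card_minColumnIndices ⟨k, blk, hform, rfl⟩
  obtain ⟨t, ht⟩ := (hfin.union (hS.finite_line_notMem hxa (r - x, 0))).exists_notMem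
  simp only [Set.mem_union, Set.mem_ofPred_eq, not_or, not_not] at ht
  refine ⟨x + t • (r - x), fun y => ?_, by simpa using ht.2⟩
  refine le_trans ?_ (hr y)
  have h1 := hle 1
  rw [← ht.1, ← R_add_smul, ← R_add_smul, one_smul, add_sub_cancel] at h1
  exact h1

theorem IsJordanKroneckerInvariant.card_minColumnIndices {ρ : 𝔤 →ₗ⁅K⁆ Module.End K V}
    {T : AlgebraicType} (hT : IsJordanKroneckerInvariant ρ T) {a : V} (ha : IsRegular ρ a) :
    Multiset.card T.minColumnIndices = Module.finrank K (stabiliser ρ a) ∧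
      Multiset.card T.minRowIndices = orbitCodim ρ a := by
  have : Infinite K := IsAlgClosed.instInfinite
  obtain ⟨x, z, ⟨S, hS, hmem, T', hT'⟩, hTxz⟩ := hT
  obtain ⟨hdim, -, hfin⟩ := hTxz.card_minColumnIndices
  obtain ⟨-, -, hfin'⟩ := (hT' _ hmem).card_minColumnIndices
  -- `T` and the constant type `T'` both belong to the pencil of `(x, z)`; at a common good `c` both
  -- column counts equal the same kernel dimension.
  obtain ⟨c, hc⟩ := (hfin.union hfin').exists_notMem
  simp only [Set.mem_union, Set.mem_ofPred_eq, not_or, not_not] at hc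
  obtain ⟨y, hy, hyS⟩ := exists_isRegular_mem ρ hS hmem
  obtain ⟨-, hle, hfin''⟩ := (hT' _ hyS).card_minColumnIndices
  obtain ⟨d, hd⟩ := hfin''.exists_notMem
  have hya : Module.finrank K (stabiliser ρ y) = Module.finrank K (stabiliser ρ a) :=
    le_antisymm (hy a) (ha y)
  have h0 := hle 0
  rw [zero_smul, add_zero] at h0
  replace h0 : Multiset.card T'.minColumnIndices ≤ Module.finrank K (stabiliser ρ y) := h0
  -- For a good `d` the right side is the dimension of the stabiliser of `y + d z`, and `y` is
  -- regular.
  have h1 : Module.finrank K (stabiliser ρ y) ≤ Multiset.card T'.minColumnIndices := by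
    rw [← not_not.1 hd, ← R_add_smul]
    exact hy _
  have hp : Multiset.card T.minColumnIndices = Module.finrank K (stabiliser ρ a) := by
    rw [← hc.1, hc.2]
    omega
  refine ⟨hp, ?_⟩
  have h2 : Module.finrank K (orbitTangent ρ a) + Module.finrank K (stabiliser ρ a) =
      Module.finrank K 𝔤 := (R ρ a).finrank_range_add_finrank_ker
  have h3 := (orbitTangent ρ a).finrank_quotient_add_finrank
  unfold orbitCodim
  omega

end Representation

end JordanKronecker

theorem mainTheorem10 {K : Type*} [Field K] [IsAlgClosed K] [CharZero K]
    {𝔤 : Type*} [LieRing 𝔤] [LieAlgebra K 𝔤] [FiniteDimensional K 𝔤]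
    {V : Type*} [AddCommGroup V] [Module K V] [FiniteDimensional K V]
    (ρ : 𝔤 →ₗ⁅K⁆ Module.End K V) :
    (∃ T : JordanKronecker.AlgebraicType, JordanKronecker.IsJordanKroneckerInvariant ρ T) ∧
    ∀ T : JordanKronecker.AlgebraicType, JordanKronecker.IsJordanKroneckerInvariant ρ T →
      ∀ a : V, JordanKronecker.IsRegular ρ a →
        Multiset.card T.minColumnIndices =
            Module.finrank K (JordanKronecker.stabiliser ρ a) ∧
        Multiset.card T.minRowIndices = JordanKronecker.orbitCodim ρ a :=
  ⟨JordanKronecker.exists_isJordanKroneckerInvariant ρ, fun _ hT _ ha => hT.card_minColumnIndices ha⟩
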